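/- There is a universal constant $C>0$ such that the following holds for every integer $n\ge 2$. Let $(\Omega,\mathcal F,\mathbb P)$ be a probability space, let $\mathcal F_0\subset\mathcal F_1\subset\dots\subset\mathcal F_n\subset\mathcal F$ be $\sigma$-fields and let $d_1,\dots,d_n\in\mathbb L^4$ be martingale differences with respect to them, i.e. $d_j$ is $\mathcal F_j$-measurable and $\mathbb E(d_j\mid\mathcal F_{j-1})=0$ a.s. for $1\le j\le n$, such that $\sum_{k=1}^n\mathbb E(d_k^2)=n$. Let $\theta=(\theta_1,\dots,\theta_n)$ be a random vector on $(\Omega,\mathcal F,\mathbb P)$, independent of $(d_1,\dots,d_n)$ and uniformly distributed on the unit sphere $S^{n-1}$ of $\mathbb R^n$, and put $S_n(\theta)=\sum_{j=1}^n\theta_jd_j$. Write $\mathbb P_{|\theta}$ for the (regular) conditional probability given $\theta$, and let $N$ be a standard normal random variable. Then $\sup_{t\in\mathbb R}\bigl|\mathbb P_{|\theta}(S_n(\theta)\le t)-\mathbb P(N\le t)\bigr|$ is integrable and $$\mathbb E\,\sup_{t\in\mathbb R}\bigl|\mathbb P_{|\theta}(S_n(\theta)\le t)-\mathbb P(N\le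 t)\bigr|\;\le\; C\,\frac{1+v_n'}{\sqrt n},$$ where $$v_n'=c_2(n)\,\sigma_4^2(n)\,\log n+\beta_n(\log n)^{3/2}+\alpha_n(\log n)^2,$$ $$\alpha_n=\sup_{1\le k\le n}\mathbb E(d_k^4),\qquad \beta_n=\mathbb E\Bigl[\Bigl(\frac1n\sum_{j=1}^n\bigl(\mathbb E(d_j^3\mid\mathcal F_{j-1})\bigr)^2\Bigr)^{1/2}\Bigr],$$ $$\sigma_4^2(n)=\frac1n\operatorname{Var}\Bigl(\sum_{k=1}^nd_k^2\Bigr),\qquad c_2(n)=\Bigl(\frac1n\sum_{k=1}^n\sum_{\ell=1}^n\bigl|\operatorname{Cov}(d_k^2,d_\ell^2)\bigr|\Bigr)^{1/2}.$$ -/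

import Mathlib

open MeasureTheory ProbabilityTheory

namespace RandomizedMartingale

noncomputable section

/-- The uniform probability measure on the unit sphere of `ℝⁿ`, as a measure on `ℝⁿ`: the surface
measure of the sphere, normalised to total mass one (`n ≥ 1`). -/
def uniformSphere (n : ℕ) : Measure (EuclideanSpace ℝ (Fin n)) :=
  Measure.map (fun x : Metric.sphere (0 : EuclideanSpace ℝ (Fin n)) 1 =>
      (x : EuclideanSpace ℝ (Fin n)))
    (((volume : Measure (EuclideanSpace ℝ (Fin n))).toSphere Set.univ)⁻¹ •
      (volume : Measure (EuclideanSpace ℝ (Fin n))).toSphere)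

/-- The Kolmogorov distance between two (probability) measures on the line. -/
def kolmogorovDist (P Q : Measure ℝ) : ℝ :=
  ⨆ t : ℝ, |P.real (Set.Iic t) - Q.real (Set.Iic t)|

variable {Ω : Type*} {mΩ : MeasurableSpace Ω} {n : ℕ}

/-- `d 0, …, d (n-1)` (that is, `d₁, …, dₙ`) are martingale differences with respect to the
increasing sigma-fields `ℱ 0 ≤ … ≤ ℱ n`: the `j`-th one, `j = 1, …, n`, is integrable and
`ℱ j`-measurable, with conditional expectation `0` given `ℱ (j - 1)`. Here `d i` is the difference
of rank `j = i + 1`, so `ℱ i.succ` is `ℱ j` and `ℱ i.castSucc` is `ℱ (j - 1)`. -/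
structure IsMartingaleDifference (d : Fin n → Ω → ℝ) (ℱ : Filtration (Fin (n + 1)) mΩ)
    (μ : Measure Ω) : Prop where
  measurable : ∀ i, Measurable[ℱ i.succ] (d i)
  integrable : ∀ i, Integrable (d i) μ
  condExp_eq_zero : ∀ i, μ[d i | ℱ i.castSucc] =ᵐ[μ] 0

/-- The randomised sum `∑ θⱼ dⱼ`, with random weights `θ`. -/
def weightedSum (θ : Ω → EuclideanSpace ℝ (Fin n)) (d : Fin n → Ω → ℝ) : Ω → ℝ :=
  fun ω => ∑ i, θ ω i * d i ω

/-- `αₙ = sup_k E (d_k⁴)`. -/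
def alpha (d : Fin n → Ω → ℝ) (μ : Measure Ω) : ℝ :=
  ⨆ k, ∫ ω, d k ω ^ 4 ∂μ

/-- `βₙ = E [(n⁻¹ ∑ⱼ (E (dⱼ³ | ℱ (j - 1)))²)^{1/2}]`. -/
def beta (d : Fin n → Ω → ℝ) (ℱ : Filtration (Fin (n + 1)) mΩ) (μ : Measure Ω) : ℝ :=
  ∫ ω, √((1 / (n : ℝ)) * ∑ j, (μ[fun ω' => d j ω' ^ 3 | ℱ j.castSucc] ω) ^ 2) ∂μ

/-- `σ₄²(n) = n⁻¹ Var (∑ d_k²)`. -/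
def sigmaFourSq (d : Fin n → Ω → ℝ) (μ : Measure Ω) : ℝ :=
  (1 / (n : ℝ)) * variance (fun ω => ∑ k, d k ω ^ 2) μ

/-- `c₂(n) = (n⁻¹ ∑_{k,ℓ} |Cov (d_k², d_ℓ²)|)^{1/2}`. -/
def cTwo (d : Fin n → Ω → ℝ) (μ : Measure Ω) : ℝ :=
  √((1 / (n : ℝ)) * ∑ k, ∑ l, |covariance (fun ω => d k ω ^ 2) (fun ω => d l ω ^ 2) μ|)

/-- `v'ₙ = c₂(n) σ₄²(n) log n + βₙ (log n)^{3/2} + αₙ (log n)²`. -/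
def vPrime (d : Fin n → Ω → ℝ) (ℱ : Filtration (Fin (n + 1)) mΩ) (μ : Measure Ω) : ℝ :=
  cTwo d μ * sigmaFourSq d μ * Real.log n + beta d ℱ μ * Real.log n ^ (3 / 2 : ℝ)
    + alpha d μ * Real.log n ^ 2

end

end RandomizedMartingale

/-!
For a direction `u` on the sphere let `f (t u)` be the characteristic function at `t` of
`S_u = ∑ uⱼ dⱼ`, so that `f` is the characteristic function of the vector `(d₁, …, dₙ)`, and let
`g t = exp (-t² / 2)`. Since `θ` is independent of the differences, the conditional law of the
weighted sum given `θ = u` is the law of `S_u` (`condDistrib_inner_ae_eq`), and it has to be shown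
that the Kolmogorov distance from `S_u` to `N` is `O ((1 + v') / √n)` on average over `u`.

Smoothing by a centred Gaussian of standard deviation `1 / √n`, which costs `O (1 / √n)`, bounds the
distance by the integral of `exp (-t² / (2 n)) |f (t u) - g t| / |t|` (`ofReal_kolmogorovDist_le`).
This integral is averaged over `u` and cut at `|t| ≈ √(log n)`.

*Low frequencies.* McLeish's product `∏ (1 + i xⱼ)` over the martingale differences `xⱼ = t uⱼ dⱼ`,
stopped when the quadratic variation becomes too large, has mean one and differs from
`exp (i ∑ xⱼ) exp (t² / 2)` only through `|∑ xⱼ² - t²|` and `∑ |xⱼ|³`. On average over the sphere,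
`∑ uⱼ² (dⱼ² - 1)` has second moment `O ((σ₄² + α) / n)` and `∑ |uⱼ|³ E |dⱼ|³` is `O (α / √n)`
(`IsMartingaleDifference.lintegral_norm_charFun_sub_le`). The moments of the sphere are obtained
from those of the standard Gaussian by polar decomposition.

*High frequencies.* The measure `dt / |t|` is invariant under dilations and the norm of a standard
Gaussian vector `G` is of order `√n` with probability at least one half, so the spherical average of
`|f (t u)|` may be replaced by the average of `|f (t G / √n)|`
(`lintegral_uniformSphere_le_stdGaussian`). By Cauchy–Schwarz and symmetrization the latter is at
most the square root of `E exp (-t² |X - Y|² / (2 n))` for independent copies `X`, `Y` of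
`(d₁, …, dₙ)`, which is small because `|X - Y|² ≥ n` outside an event of probability
`O ((σ₄² + α) / n)` (`prod_real_norm_sub_sq_lt_le`); this uses the orthogonality of the differences.

The two ranges add up to `O ((1 + √(σ₄² + α) log n + α (log n)²) / √n)`. This is of the required
order since `√σ₄² ≤ c₂`, whence `√σ₄² ≤ 1 + c₂ σ₄²`, and `α ≥ 1`; the remaining term of `v'` is
nonnegative (`frequency_bound_le`, `le_vPrime`).
-/

namespace RandomizedMartingale

open scoped NNReal ENNReal RealInnerProductSpace

/-! ### McLeish's comparison for martingale differences -/

section McLeish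

lemma norm_one_add_mul_I_le_exp (x : ℝ) : ‖(1 + x * Complex.I : ℂ)‖ ≤ Real.exp (x ^ 2 / 2) := by
  rw [Complex.norm_def, Complex.normSq_apply, Real.sqrt_le_left (Real.exp_nonneg _),
    ← Real.exp_nat_mul]
  have := Real.add_one_le_exp (x ^ 2)
  simp only [Complex.add_re, Complex.one_re, Complex.mul_re, Complex.ofReal_re, Complex.I_re,
    mul_zero, Complex.ofReal_im, Complex.I_im, sub_self, add_zero, Complex.add_im,
    Complex.one_im, Complex.mul_im, mul_one, zero_add]
  have h2 : ((2 : ℕ) : ℝ) * (x ^ 2 / 2) = x ^ 2 := by push_cast; ring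
  rw [h2]
  linarith

lemma norm_one_add_mul_I_le (x : ℝ) : ‖(1 + x * Complex.I : ℂ)‖ ≤ 1 + |x| := by
  refine (norm_add_le _ _).trans ?_
  simp

lemma norm_one_add_mul_I_mul_exp_le_one (x : ℝ) :
    ‖((1 + x * Complex.I) * Real.exp (-x ^ 2 / 2) : ℂ)‖ ≤ 1 := by
  rw [norm_mul, Complex.norm_real, Real.norm_of_nonneg (Real.exp_nonneg _)]
  calc _ ≤ Real.exp (x ^ 2 / 2) * Real.exp (-x ^ 2 / 2) := by
        gcongr; exact norm_one_add_mul_I_le_exp x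
    _ = 1 := by rw [← Real.exp_add]; simp [neg_div]

/-- McLeish's factorisation: `(1 + ix) e^{-x²/2}` agrees with `e^{ix}` up to third order. -/
lemma norm_exp_mul_I_sub_le (x : ℝ) :
    ‖Complex.exp (x * Complex.I) - (1 + x * Complex.I) * Real.exp (-x ^ 2 / 2)‖ ≤ 2 * |x| ^ 3 := by
  rcases le_or_gt |x| 1 with hx | hx
  · have h1 : ‖Complex.exp (x * Complex.I) - (1 + x * Complex.I - (x : ℂ) ^ 2 / 2)‖
        ≤ |x| ^ 3 * (4 / 18) := by
      have := Complex.exp_bound (x := x * Complex.I) (by simpa using hx) (n := 3) (by norm_num)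
      simp only [Finset.sum_range_succ, Finset.sum_range_zero, norm_mul, Complex.norm_real,
        Complex.norm_I, mul_one, Real.norm_eq_abs] at this
      have e : (0 + (↑x * Complex.I) ^ 0 / ↑(Nat.factorial 0) +
          (↑x * Complex.I) ^ 1 / ↑(Nat.factorial 1) + (↑x * Complex.I) ^ 2 / ↑(Nat.factorial 2) : ℂ)
          = 1 + x * Complex.I - (x : ℂ) ^ 2 / 2 := by
        simp [Nat.factorial, mul_pow]; ring
      rw [e] at this
      refine this.trans (le_of_eq ?_)
      norm_num [Nat.factorial]
    have h2 : ‖(Real.exp (-x ^ 2 / 2) : ℂ) - (1 - (x : ℂ) ^ 2 / 2)‖ ≤ |x| ^ 4 * (3 / 16) := by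
      have hx2 : |(-x ^ 2 / 2)| = |x| ^ 2 / 2 := by rw [abs_div, abs_neg, abs_pow]; simp
      have hx3 : |(-x ^ 2 / 2)| ≤ 1 := by
        rw [hx2]; nlinarith [abs_nonneg x]
      have := Complex.exp_bound (x := ((-x ^ 2 / 2 : ℝ) : ℂ))
        (by rw [Complex.norm_real]; exact hx3) (n := 2) (by norm_num)
      simp only [Finset.sum_range_succ, Finset.sum_range_zero, Complex.norm_real,
        Real.norm_eq_abs, hx2] at this
      have e : (0 + ((-x ^ 2 / 2 : ℝ) : ℂ) ^ 0 / ↑(Nat.factorial 0) +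
          ((-x ^ 2 / 2 : ℝ) : ℂ) ^ 1 / ↑(Nat.factorial 1) : ℂ) = 1 - (x : ℂ) ^ 2 / 2 := by
        simp [Nat.factorial]; ring
      rw [e] at this
      rw [Complex.ofReal_exp]
      refine this.trans (le_of_eq ?_)
      rw [div_pow, ← pow_mul]
      norm_num [Nat.factorial]
      ring
    have e : Complex.exp (x * Complex.I) - (1 + x * Complex.I) * Real.exp (-x ^ 2 / 2)
        = (Complex.exp (x * Complex.I) - (1 + x * Complex.I - (x : ℂ) ^ 2 / 2))
          - (1 + x * Complex.I) * ((Real.exp (-x ^ 2 / 2) : ℂ) - (1 - (x : ℂ) ^ 2 / 2))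
          + (x : ℂ) ^ 3 * Complex.I / 2 := by
      ring
    rw [e]
    have h3 : ‖((x : ℂ) ^ 3 * Complex.I / 2)‖ = |x| ^ 3 / 2 := by simp
    have h4 : ‖(1 + x * Complex.I) * ((Real.exp (-x ^ 2 / 2) : ℂ) - (1 - (x : ℂ) ^ 2 / 2))‖
        ≤ 2 * (|x| ^ 3 * (3 / 16)) := by
      rw [norm_mul]
      gcongr
      · exact (norm_one_add_mul_I_le x).trans (by linarith)
      · refine h2.trans ?_
        have : |x| ^ 4 ≤ |x| ^ 3 := pow_le_pow_of_le_one (abs_nonneg x) hx (by norm_num)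
        linarith
    refine (norm_add_le _ _).trans ?_
    have h5 := norm_sub_le (Complex.exp (x * Complex.I) - (1 + x * Complex.I - (x : ℂ) ^ 2 / 2))
      ((1 + x * Complex.I) * ((Real.exp (-x ^ 2 / 2) : ℂ) - (1 - (x : ℂ) ^ 2 / 2)))
    have : 0 ≤ |x| ^ 3 := by positivity
    linarith
  · refine (norm_sub_le _ _).trans ?_
    rw [Complex.norm_exp_ofReal_mul_I]
    have := norm_one_add_mul_I_mul_exp_le_one x
    have : 1 ≤ |x| ^ 3 := one_le_pow₀ hx.le
    linarith

lemma norm_prod_sub_prod_le {ι : Type*} (s : Finset ι) (a b : ι → ℂ)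
    (ha : ∀ i, ‖a i‖ ≤ 1) (hb : ∀ i, ‖b i‖ ≤ 1) :
    ‖∏ i ∈ s, a i - ∏ i ∈ s, b i‖ ≤ ∑ i ∈ s, ‖a i - b i‖ := by
  classical
  induction s using Finset.induction_on with
  | empty => simp
  | insert i s hi ih =>
    rw [Finset.prod_insert hi, Finset.prod_insert hi, Finset.sum_insert hi]
    have e : a i * ∏ j ∈ s, a j - b i * ∏ j ∈ s, b j
        = (a i - b i) * ∏ j ∈ s, a j + b i * (∏ j ∈ s, a j - ∏ j ∈ s, b j) := by ring
    rw [e]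
    refine (norm_add_le _ _).trans ?_
    rw [norm_mul, norm_mul, norm_prod]
    gcongr
    · exact mul_le_of_le_one_right (norm_nonneg _)
        (Finset.prod_le_one (fun _ _ => norm_nonneg _) fun j _ => ha j)
    · exact (mul_le_of_le_one_left (norm_nonneg _) (hb i)).trans ih

/-- The increment `x k`, switched off once the quadratic variation of the increments before it
exceeds the level `L`. -/
noncomputable def stoppedIncrement (L : ℝ) (x : ℕ → ℝ) (k : ℕ) : ℝ :=
  if ∑ i ∈ Finset.range k, x i ^ 2 ≤ L then x k else 0

/-- The product `∏ (1 + i xⱼ)` along the increments stopped at level `L`. It is a complex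
martingale of mean one when the `xⱼ` are martingale differences. -/
noncomputable def stoppedProd (L : ℝ) (x : ℕ → ℝ) (k : ℕ) : ℂ :=
  ∏ j ∈ Finset.range k, (1 + stoppedIncrement L x j * Complex.I)

lemma sum_sq_range_mono (x : ℕ → ℝ) {j k : ℕ} (h : j ≤ k) :
    ∑ i ∈ Finset.range j, x i ^ 2 ≤ ∑ i ∈ Finset.range k, x i ^ 2 :=
  Finset.sum_le_sum_of_subset_of_nonneg (Finset.range_mono h) fun _ _ _ => sq_nonneg _

lemma stoppedProd_eq_of_le {L : ℝ} {x : ℕ → ℝ} {k : ℕ}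
    (h : ∑ i ∈ Finset.range k, x i ^ 2 ≤ L) :
    stoppedProd L x k = ∏ j ∈ Finset.range k, (1 + x j * Complex.I) := by
  refine Finset.prod_congr rfl fun j hj => ?_
  rw [stoppedIncrement, if_pos ((sum_sq_range_mono x (Finset.mem_range.1 hj).le).trans h)]

lemma norm_prod_one_add_le (x : ℕ → ℝ) (k : ℕ) :
    ‖∏ j ∈ Finset.range k, (1 + x j * Complex.I)‖
      ≤ Real.exp ((∑ i ∈ Finset.range k, x i ^ 2) / 2) := by
  rw [norm_prod, Finset.sum_div, Real.exp_sum]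
  exact Finset.prod_le_prod (fun _ _ => norm_nonneg _) fun j _ => norm_one_add_mul_I_le_exp _

/-- Only the last increment before stopping can push the quadratic variation above `L`, so the
stopped product exceeds `e^{L/2}` by at most one factor. -/
lemma norm_stoppedProd_le {L : ℝ} (hL : 0 ≤ L) (x : ℕ → ℝ) (k : ℕ) :
    ‖stoppedProd L x k‖ ≤ Real.exp (L / 2) * (2 * (1 + ∑ i ∈ Finset.range k, |x i| ^ 3)) := by
  induction k with
  | zero =>
    simp only [stoppedProd, Finset.range_zero, Finset.prod_empty, norm_one, Finset.sum_empty]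
    have : 1 ≤ Real.exp (L / 2) := Real.one_le_exp (by positivity)
    linarith
  | succ k ih =>
    have hS : 0 ≤ ∑ i ∈ Finset.range k, |x i| ^ 3 := by positivity
    have hk : 0 ≤ |x k| ^ 3 := by positivity
    have hrec : stoppedProd L x (k + 1)
        = stoppedProd L x k * (1 + stoppedIncrement L x k * Complex.I) := by
      rw [stoppedProd, Finset.prod_range_succ, ← stoppedProd]
    rw [hrec, Finset.sum_range_succ, norm_mul]
    by_cases h : ∑ i ∈ Finset.range k, x i ^ 2 ≤ L
    · rw [stoppedIncrement, if_pos h, stoppedProd_eq_of_le h]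
      have h1 : ‖∏ j ∈ Finset.range k, (1 + x j * Complex.I : ℂ)‖ ≤ Real.exp (L / 2) :=
        (norm_prod_one_add_le x k).trans (Real.exp_le_exp.2 (by linarith))
      gcongr
      refine (norm_one_add_mul_I_le _).trans ?_
      have : |x k| ≤ 1 + |x k| ^ 3 := by
        rcases le_or_gt |x k| 1 with h | h
        · linarith
        · have : |x k| ≤ |x k| ^ 3 := le_self_pow₀ h.le (by norm_num)
          linarith
      linarith
    · rw [stoppedIncrement, if_neg h]
      simp only [Complex.ofReal_zero, zero_mul, add_zero, norm_one, mul_one]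
      refine ih.trans ?_
      gcongr
      linarith

/-- Pointwise form of McLeish's comparison; the mean of `stoppedProd` being one, integrating it
compares the characteristic function with that of a normal law of variance `v`. -/
lemma norm_exp_sum_sub_stoppedProd_le {v : ℝ} (hv : 0 ≤ v) (x : ℕ → ℝ) (n : ℕ) :
    ‖Complex.exp ((∑ k ∈ Finset.range n, x k : ℝ) * Complex.I)
        - stoppedProd (v + 1) x n * Real.exp (-v / 2)‖
      ≤ 5 * |∑ k ∈ Finset.range n, x k ^ 2 - v| + 4 * ∑ k ∈ Finset.range n, |x k| ^ 3 := by
  set V := ∑ k ∈ Finset.range n, x k ^ 2 with hV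
  set S := ∑ k ∈ Finset.range n, |x k| ^ 3 with hS
  have hS0 : 0 ≤ S := by positivity
  have hsqrt : Real.exp (1 / 2) ≤ 1.65 := by
    have h := Real.exp_one_lt_d9
    have h2 : Real.exp (1 / 2) ^ 2 = Real.exp 1 := by rw [← Real.exp_nat_mul]; norm_num
    nlinarith [Real.exp_pos (1 / 2 : ℝ)]
  -- Up to the level `v + 1` nothing is stopped and the factorisation applies to every factor; above
  -- it, `|V - v| > 1`, so that crude bounds suffice.
  rcases le_or_gt V (v + 1) with h | h
  · rw [stoppedProd_eq_of_le h]
    have e1 : Complex.exp ((∑ k ∈ Finset.range n, x k : ℝ) * Complex.I)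
        = ∏ k ∈ Finset.range n, Complex.exp (x k * Complex.I) := by
      rw [← Complex.exp_sum, Complex.ofReal_sum, Finset.sum_mul]
    have e2 : ∏ k ∈ Finset.range n, ((1 + x k * Complex.I) * Real.exp (-x k ^ 2 / 2) : ℂ)
        = (∏ k ∈ Finset.range n, (1 + x k * Complex.I)) * Real.exp (-V / 2) := by
      rw [Finset.prod_mul_distrib, ← Complex.ofReal_prod, ← Real.exp_sum, ← Finset.sum_div,
        Finset.sum_neg_distrib]
    have h1 := norm_prod_sub_prod_le (Finset.range n) (fun k => Complex.exp (x k * Complex.I))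
      (fun k => ((1 + x k * Complex.I) * Real.exp (-x k ^ 2 / 2) : ℂ))
      (fun k => (Complex.norm_exp_ofReal_mul_I _).le)
      (fun k => norm_one_add_mul_I_mul_exp_le_one _)
    have h2 : ∑ k ∈ Finset.range n, ‖Complex.exp (x k * Complex.I)
        - ((1 + x k * Complex.I) * Real.exp (-x k ^ 2 / 2) : ℂ)‖ ≤ 2 * S := by
      rw [hS, Finset.mul_sum]
      exact Finset.sum_le_sum fun k _ => norm_exp_mul_I_sub_le _
    rw [← e1, e2] at h1
    have h3 : ‖(∏ k ∈ Finset.range n, (1 + x k * Complex.I)) * Real.exp (-V / 2)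
        - (∏ k ∈ Finset.range n, (1 + x k * Complex.I)) * Real.exp (-v / 2)‖
        ≤ 1.65 * (|V - v| / 2) := by
      rw [← mul_sub, norm_mul, ← Complex.ofReal_sub, Complex.norm_real, Real.norm_eq_abs]
      have hexp : Real.exp (-V / 2) - Real.exp (-v / 2)
          = Real.exp (-V / 2) * (1 - Real.exp ((V - v) / 2)) := by
        rw [mul_sub, ← Real.exp_add]; ring_nf
      rw [hexp, abs_mul, abs_of_pos (Real.exp_pos _), ← mul_assoc]
      have h4 : ‖∏ k ∈ Finset.range n, (1 + x k * Complex.I : ℂ)‖ * Real.exp (-V / 2) ≤ 1 := by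
        calc _ ≤ Real.exp (V / 2) * Real.exp (-V / 2) := by
              gcongr; exact norm_prod_one_add_le x n
          _ = 1 := by rw [← Real.exp_add]; simp [neg_div]
      have h5 : |1 - Real.exp ((V - v) / 2)| ≤ 1.65 * (|V - v| / 2) := by
        set z := (V - v) / 2 with hz
        have hz2 : z ≤ 1 / 2 := by rw [hz]; linarith
        have hzabs : |V - v| / 2 = |z| := by rw [hz, abs_div]; simp
        rw [hzabs]
        have a1 := Real.add_one_le_exp z
        have a2 := Real.add_one_le_exp (-z)
        have a3 : Real.exp z * Real.exp (-z) = 1 := by rw [← Real.exp_add]; simp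
        have a4 : Real.exp z ≤ 1.65 := (Real.exp_le_exp.2 hz2).trans hsqrt
        have a5 := Real.exp_pos z
        rw [abs_le]
        constructor
        · have : Real.exp z * (1 - z) ≤ 1 := by nlinarith
          rcases le_or_gt 0 z with h0 | h0
          · rw [abs_of_nonneg h0]; nlinarith
          · have : Real.exp z ≤ 1 := Real.exp_le_one_iff.2 h0.le
            have := abs_nonneg z
            linarith
        · have := neg_abs_le z
          have := abs_nonneg z
          linarith
      calc _ ≤ 1 * |1 - Real.exp ((V - v) / 2)| := by gcongr
        _ ≤ _ := by rw [one_mul]; exact h5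
    have h6 := norm_sub_le_norm_sub_add_norm_sub
      (Complex.exp ((∑ k ∈ Finset.range n, x k : ℝ) * Complex.I))
      ((∏ k ∈ Finset.range n, (1 + x k * Complex.I)) * Real.exp (-V / 2))
      ((∏ k ∈ Finset.range n, (1 + x k * Complex.I)) * Real.exp (-v / 2))
    have := abs_nonneg (V - v)
    linarith
  · have h1 : 1 ≤ |V - v| := by
      rw [abs_of_pos (by linarith)]; linarith
    refine (norm_sub_le _ _).trans ?_
    rw [Complex.norm_exp_ofReal_mul_I, norm_mul, Complex.norm_real,
      Real.norm_of_nonneg (Real.exp_nonneg _)]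
    have h2 := norm_stoppedProd_le (L := v + 1) (by linarith) x n
    have h3 : ‖stoppedProd (v + 1) x n‖ * Real.exp (-v / 2) ≤ 1.65 * (2 * (1 + S)) := by
      calc _ ≤ Real.exp ((v + 1) / 2) * (2 * (1 + S)) * Real.exp (-v / 2) := by gcongr
        _ = Real.exp (1 / 2) * (2 * (1 + S)) := by
          have : Real.exp (1 / 2) = Real.exp ((v + 1) / 2) * Real.exp (-v / 2) := by
            rw [← Real.exp_add]; ring_nf
          rw [this]; ring
        _ ≤ _ := by gcongr
    linarith

variable {Ω : Type*} {mΩ : MeasurableSpace Ω} {μ : Measure Ω} [IsProbabilityMeasure μ]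

lemma integral_mul_eq_zero_of_condExp_eq_zero {m : MeasurableSpace Ω} (hm : m ≤ mΩ)
    {f : Ω → ℂ} {g : Ω → ℝ} (hf : StronglyMeasurable[m] f) {c : ℝ} (hc : ∀ ω, ‖f ω‖ ≤ c)
    (hg : Integrable g μ) (h0 : μ[g | m] =ᵐ[μ] 0) : ∫ ω, f ω * g ω ∂μ = 0 := by
  have h := condExp_stronglyMeasurable_bilin_of_bound
    (ContinuousLinearMap.lsmul ℝ ℝ (E := ℂ)).flip hm hf hg c (ae_of_all _ hc) (μ := μ)
  have e : (fun ω => f ω * (g ω : ℂ))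
      = fun ω => (ContinuousLinearMap.lsmul ℝ ℝ (E := ℂ)).flip (f ω) (g ω) := by
    ext ω; simp [mul_comm]
  rw [e, ← integral_condExp hm, integral_congr_ae h]
  rw [integral_eq_zero_of_ae]
  filter_upwards [h0] with ω hω
  simp [hω]

/-- The characteristic function of a sum of martingale differences is close to that of a normal
law of variance `v` as soon as the quadratic variation is close to `v` in `L¹` and the third
absolute moments are small. -/
theorem norm_integral_exp_sub_le {ℱ : Filtration ℕ mΩ} {x : ℕ → Ω → ℝ}
    (hx : ∀ k, Measurable[ℱ (k + 1)] (x k)) (hint : ∀ k, Integrable (x k) μ)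
    (hint2 : ∀ k, Integrable (fun ω => x k ω ^ 2) μ)
    (hint3 : ∀ k, Integrable (fun ω => |x k ω| ^ 3) μ)
    (h0 : ∀ k, μ[x k | ℱ k] =ᵐ[μ] 0) {v : ℝ} (hv : 0 ≤ v) (n : ℕ) :
    ‖∫ ω, Complex.exp ((∑ k ∈ Finset.range n, x k ω : ℝ) * Complex.I) ∂μ - Real.exp (-v / 2)‖
      ≤ ∫ ω, (5 * |∑ k ∈ Finset.range n, x k ω ^ 2 - v|
          + 4 * ∑ k ∈ Finset.range n, |x k ω| ^ 3) ∂μ := by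
  have hxm : ∀ k, Measurable (x k) := fun k => (hx k).mono (ℱ.le _) le_rfl
  set L := v + 1 with hL
  have hL0 : 0 ≤ L := by linarith
  have hmeasV : ∀ k j, k ≤ j → Measurable[ℱ j] (fun ω => ∑ i ∈ Finset.range k, x i ω ^ 2) := by
    intro k j hkj
    refine Finset.measurable_sum _ fun i hi => ?_
    have hi' := Finset.mem_range.1 hi
    exact Measurable.pow_const ((hx i).mono (ℱ.mono (by omega)) le_rfl) 2
  have hmeasI : ∀ k, Measurable[ℱ (k + 1)] (fun ω => stoppedIncrement L (fun i => x i ω) k) := by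
    intro k
    unfold stoppedIncrement
    refine Measurable.ite ?_ (hx k) measurable_const
    exact measurableSet_Iic.preimage (hmeasV k (k + 1) (by omega))
  have hmeasT : ∀ k, Measurable[ℱ k] (fun ω => stoppedProd L (fun i => x i ω) k) := by
    intro k
    unfold stoppedProd
    refine Finset.measurable_prod _ fun i hi => ?_
    have hi' := Finset.mem_range.1 hi
    have h1 := (hmeasI i).mono (ℱ.mono (show i + 1 ≤ k by omega)) le_rfl
    exact measurable_const.add ((Complex.measurable_ofReal.comp h1).mul_const _)
  have hTint : ∀ k, Integrable (fun ω => stoppedProd L (fun i => x i ω) k) μ := by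
    intro k
    refine Integrable.mono' (g := fun ω =>
      Real.exp (L / 2) * (2 * (1 + ∑ i ∈ Finset.range k, |x i ω| ^ 3))) ?_
      ((hmeasT k).mono (ℱ.le _) le_rfl).aestronglyMeasurable
      (ae_of_all _ fun ω => norm_stoppedProd_le hL0 _ k)
    exact (((integrable_const _).add (integrable_finsetSum _ fun i _ => hint3 i)).const_mul
      _).const_mul _
  have hT : ∀ k, ∫ ω, stoppedProd L (fun i => x i ω) k ∂μ = 1 := by
    intro k
    induction k with
    | zero => simp [stoppedProd]
    | succ k ih =>
      -- `G * x k` is the increment of the stopped product; `G` is bounded and measurable with respect to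
      -- the past of `x k`.
      let G : Ω → ℂ := fun ω => if ∑ i ∈ Finset.range k, x i ω ^ 2 ≤ L then
        stoppedProd L (fun i => x i ω) k * Complex.I else 0
      have e : (fun ω => stoppedProd L (fun i => x i ω) (k + 1))
          = fun ω => stoppedProd L (fun i => x i ω) k + G ω * x k ω := by
        ext ω
        simp only [G]
        rw [stoppedProd, Finset.prod_range_succ, ← stoppedProd]
        unfold stoppedIncrement
        split_ifs
        · ring
        · simp
      have hGm : Measurable[ℱ k] G := by
        refine Measurable.ite ?_ ((hmeasT k).mul_const _) measurable_const
        exact measurableSet_Iic.preimage (hmeasV k k le_rfl)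
      have hGb : ∀ ω, ‖G ω‖ ≤ Real.exp (L / 2) := by
        intro ω
        simp only [G]
        split_ifs with h
        · rw [norm_mul, Complex.norm_I, mul_one, stoppedProd_eq_of_le h]
          exact (norm_prod_one_add_le _ k).trans (Real.exp_le_exp.2 (by linarith))
        · simpa using Real.exp_nonneg _
      have hGz := integral_mul_eq_zero_of_condExp_eq_zero (ℱ.le k) hGm.stronglyMeasurable hGb
        (hint k) (h0 k)
      have hGi : Integrable (fun ω => G ω * x k ω) μ :=
        Integrable.bdd_mul (hint k).ofReal
          (hGm.mono (ℱ.le _) le_rfl).aestronglyMeasurable (ae_of_all _ hGb)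
      rw [e, integral_add (hTint k) hGi, ih, hGz, add_zero]
  have hexpint : Integrable
      (fun ω => Complex.exp ((∑ k ∈ Finset.range n, x k ω : ℝ) * Complex.I)) μ := by
    refine Integrable.mono' (integrable_const (1 : ℝ)) ?_
      (ae_of_all _ fun ω => (Complex.norm_exp_ofReal_mul_I _).le)
    have : Measurable fun ω => ∑ k ∈ Finset.range n, x k ω :=
      Finset.measurable_sum _ fun k _ => hxm k
    exact Measurable.aestronglyMeasurable (by fun_prop)
  have e : ∫ ω, Complex.exp ((∑ k ∈ Finset.range n, x k ω : ℝ) * Complex.I) ∂μ - Real.exp (-v / 2)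
      = ∫ ω, (Complex.exp ((∑ k ∈ Finset.range n, x k ω : ℝ) * Complex.I)
        - stoppedProd L (fun i => x i ω) n * Real.exp (-v / 2)) ∂μ := by
    rw [integral_sub hexpint ((hTint n).mul_const _), integral_mul_const, hT, one_mul]
  rw [e]
  refine norm_integral_le_of_norm_le ?_
    (ae_of_all _ fun ω => norm_exp_sum_sub_stoppedProd_le hv (fun i => x i ω) n)
  exact ((((integrable_finsetSum _ fun i _ => hint2 i).sub (integrable_const v)).abs).const_mul
    5).add ((integrable_finsetSum _ fun i _ => hint3 i).const_mul 4)

end McLeish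

/-! ### Gaussian smoothing and the Kolmogorov distance -/

section Smoothing

lemma integral_exp_neg_mul_sq_mul_cos {b : ℝ} (hb : 0 < b) (y : ℝ) :
    ∫ t : ℝ, Real.exp (-b * t ^ 2) * Real.cos (t * y)
      = √(Real.pi / b) * Real.exp (-y ^ 2 / (4 * b)) := by
  have h := fourierIntegral_gaussian (b := (b : ℂ)) (by simpa using hb) (y : ℂ)
  have e1 : ∀ t : ℝ, Complex.exp (Complex.I * y * t) * Complex.exp (-b * t ^ 2)
      = Complex.exp ((y * t : ℝ) * Complex.I) * (Real.exp (-b * t ^ 2) : ℝ) := by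
    intro t; push_cast; ring_nf
  have hint : Integrable (fun t : ℝ => Complex.exp ((y * t : ℝ) * Complex.I)
      * (Real.exp (-b * t ^ 2) : ℝ)) := by
    refine Integrable.bdd_mul (c := 1) (integrable_exp_neg_mul_sq hb).ofReal
      (Continuous.aestronglyMeasurable (by fun_prop))
      (ae_of_all _ fun t => (Complex.norm_exp_ofReal_mul_I _).le)
  have e2 : ((Real.pi : ℂ) / b) ^ (1 / 2 : ℂ) * Complex.exp (-(y : ℂ) ^ 2 / (4 * b))
      = ((√(Real.pi / b) * Real.exp (-y ^ 2 / (4 * b)) : ℝ) : ℂ) := by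
    rw [Real.sqrt_eq_rpow]
    push_cast
    rw [Complex.ofReal_cpow (by positivity)]
    push_cast
    rfl
  simp_rw [e1] at h
  rw [e2] at h
  have h2 := congrArg Complex.re h
  rw [Complex.ofReal_re] at h2
  rw [← h2]
  change _ = Complex.reCLM _
  rw [← Complex.reCLM.integral_comp_comm hint]
  refine integral_congr_ae (ae_of_all _ fun t => ?_)
  simp only [Complex.reCLM_apply]
  rw [Complex.re_mul_ofReal, Complex.exp_ofReal_mul_I_re, mul_comm, mul_comm t]

lemma integral_exp_neg_mul_sq_mul_cos_eq_pdf {v : ℝ≥0} (hv : v ≠ 0) (y : ℝ) :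
    ∫ t : ℝ, Real.exp (-(v / 2 : ℝ) * t ^ 2) * Real.cos (t * y)
      = 2 * Real.pi * gaussianPDFReal 0 v y := by
  have hv' : (0 : ℝ) < v := by positivity
  rw [integral_exp_neg_mul_sq_mul_cos (by positivity), gaussianPDFReal, ← mul_assoc]
  congr 1
  · rw [Real.sqrt_eq_iff_mul_self_eq (by positivity) (by positivity)]
    have h := Real.mul_self_sqrt (show (0 : ℝ) ≤ 2 * Real.pi * v by positivity)
    set r := √(2 * Real.pi * v) with hr
    have hs : 0 < r := by positivity
    rw [show 2 * Real.pi * r⁻¹ * (2 * Real.pi * r⁻¹) = (2 * Real.pi) ^ 2 / (r * r) by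
      field_simp, h]
    field_simp
  · congr 1
    rw [sub_zero]; congr 1; ring

/-- The kernel of the Fourier representation of the centred normal distribution function of
variance `v`. -/
noncomputable def cdfKernel (v z t : ℝ) : ℝ := Real.exp (-(v / 2) * t ^ 2) * (Real.sin (t * z) / t)

lemma abs_cdfKernel_le (v z t : ℝ) :
    |cdfKernel v z t| ≤ Real.exp (-(v / 2) * t ^ 2) * |z| := by
  rw [cdfKernel, abs_mul, abs_of_pos (Real.exp_pos _)]
  refine mul_le_mul_of_nonneg_left ?_ (Real.exp_nonneg _)
  rcases eq_or_ne t 0 with rfl | ht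
  · simp
  · rw [abs_div, div_le_iff₀ (abs_pos.2 ht), ← abs_mul, mul_comm z]
    exact Real.abs_sin_le_abs

lemma measurable_cdfKernel (v : ℝ) : Measurable (Function.uncurry (cdfKernel v)) := by
  unfold cdfKernel Function.uncurry
  fun_prop

/-- Fourier representation of the centred normal distribution function: the density is written as a
cosine integral and integrated from `0` to `z` under the integral sign. -/
lemma real_Iic_sub_real_Iic_eq {v : ℝ≥0} (hv : v ≠ 0) (z : ℝ) :
    (gaussianReal 0 v).real (Set.Iic z) - (gaussianReal 0 v).real (Set.Iic 0)
      = (2 * Real.pi)⁻¹ * ∫ t : ℝ, cdfKernel v z t := by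
  have hv' : (0 : ℝ) < v := by positivity
  have h1 : ∀ a, (gaussianReal 0 v).real (Set.Iic a)
      = ∫ x in Set.Iic a, gaussianPDFReal 0 v x := by
    intro a
    rw [measureReal_def, gaussianReal_apply_eq_integral _ hv, ENNReal.toReal_ofReal]
    exact integral_nonneg fun x => gaussianPDFReal_nonneg _ _ _
  have h2 : ∀ y, gaussianPDFReal 0 v y = (2 * Real.pi)⁻¹ *
      ∫ t : ℝ, Real.exp (-(v / 2 : ℝ) * t ^ 2) * Real.cos (t * y) := by
    intro y
    rw [integral_exp_neg_mul_sq_mul_cos_eq_pdf hv]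
    field_simp
  rw [h1, h1, intervalIntegral.integral_Iic_sub_Iic (integrable_gaussianPDFReal _ _).integrableOn
    (integrable_gaussianPDFReal _ _).integrableOn]
  simp_rw [h2]
  rw [intervalIntegral.integral_const_mul, intervalIntegral_integral_swap]
  · congr 1
    refine integral_congr_ae ?_
    have h0 : ∀ᵐ t : ℝ, t ≠ 0 := by simp [ae_iff]
    filter_upwards [h0] with t ht
    rw [intervalIntegral.integral_const_mul, intervalIntegral.integral_comp_mul_left _ ht,
      integral_cos]
    simp [cdfKernel, div_eq_inv_mul]
  · have h3 : Integrable (fun t : ℝ => Real.exp (-(v / 2 : ℝ) * t ^ 2)) :=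
      integrable_exp_neg_mul_sq (by positivity)
    have h4 : Integrable (fun p : ℝ × ℝ => (1 : ℝ) * Real.exp (-(v / 2 : ℝ) * p.2 ^ 2))
        ((volume.restrict (Set.uIoc 0 z)).prod volume) := by
      have : IntegrableOn (fun _ : ℝ => (1 : ℝ)) (Set.uIoc 0 z) :=
        integrableOn_const (by simp [Set.uIoc])
      exact Integrable.mul_prod this h3
    refine h4.mono' (Continuous.aestronglyMeasurable ?_) (ae_of_all _ fun p => ?_)
    · unfold Function.uncurry; fun_prop
    · simp only [Function.uncurry, norm_mul, Real.norm_eq_abs, abs_of_pos (Real.exp_pos _), one_mul]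
      exact mul_le_of_le_one_right (Real.exp_nonneg _) (Real.abs_cos_le_one _)

variable {P Q : Measure ℝ} [IsProbabilityMeasure P] [IsProbabilityMeasure Q]

lemma integral_sin_eq_im (w t : ℝ) :
    ∫ x, Real.sin (t * (w - x)) ∂P
      = (Complex.exp ((t * w : ℝ) * Complex.I) * charFun P (-t)).im := by
  rw [charFun_apply_real, ← integral_const_mul]
  have hint : Integrable (fun x : ℝ => Complex.exp ((t * w : ℝ) * Complex.I)
      * Complex.exp ((-t : ℝ) * x * Complex.I)) P := by
    refine Integrable.mono' (integrable_const (1 : ℝ))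
      (Continuous.aestronglyMeasurable (by fun_prop)) (ae_of_all _ fun x => ?_)
    rw [norm_mul, Complex.norm_exp_ofReal_mul_I, ← Complex.ofReal_mul,
      Complex.norm_exp_ofReal_mul_I, one_mul]
  change _ = Complex.imCLM _
  rw [← Complex.imCLM.integral_comp_comm hint]
  refine integral_congr_ae (ae_of_all _ fun x => ?_)
  simp only [Complex.imCLM_apply]
  rw [← Complex.exp_add, ← Complex.ofReal_mul, ← add_mul, ← Complex.ofReal_add,
    Complex.exp_ofReal_mul_I_im]
  congr 1; ring

lemma integral_real_Iic_sub_eq {v : ℝ≥0} (hv : v ≠ 0) (hP : Integrable (fun x => x) P) (w : ℝ) :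
    Integrable (fun t => Real.exp (-(v / 2 : ℝ) * t ^ 2) *
        ((∫ x, Real.sin (t * (w - x)) ∂P) / t)) ∧
    ∫ x, (gaussianReal 0 v).real (Set.Iic (w - x)) ∂P
      = (gaussianReal 0 v).real (Set.Iic 0) + (2 * Real.pi)⁻¹ *
        ∫ t : ℝ, Real.exp (-(v / 2 : ℝ) * t ^ 2) * ((∫ x, Real.sin (t * (w - x)) ∂P) / t) := by
  have hv' : (0 : ℝ) < v := by positivity
  have h3 : Integrable (fun t : ℝ => Real.exp (-(v / 2 : ℝ) * t ^ 2)) :=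
    integrable_exp_neg_mul_sq (by positivity)
  have h4 : Integrable (Function.uncurry fun x t => cdfKernel v (w - x) t) (P.prod volume) := by
    have h5 : Integrable (fun p : ℝ × ℝ => |w - p.1| * Real.exp (-(v / 2 : ℝ) * p.2 ^ 2))
        (P.prod volume) :=
      Integrable.mul_prod (f := fun x => |w - x|) ((integrable_const w).sub hP).abs h3
    refine h5.mono' ?_ (ae_of_all _ fun p => ?_)
    · exact ((measurable_cdfKernel v).comp
        (show Measurable fun p : ℝ × ℝ => (w - p.1, p.2) by fun_prop)).aestronglyMeasurable
    · rw [mul_comm]; exact abs_cdfKernel_le _ _ _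
  have e : ∀ t : ℝ, ∫ x, cdfKernel v (w - x) t ∂P
      = Real.exp (-(v / 2 : ℝ) * t ^ 2) * ((∫ x, Real.sin (t * (w - x)) ∂P) / t) := by
    intro t
    simp only [cdfKernel]
    rw [integral_const_mul, integral_div]
  have h6 : Integrable (fun x => ∫ t, cdfKernel v (w - x) t) P := h4.integral_prod_left
  constructor
  · simp_rw [← e]
    exact h4.integral_prod_right
  · have h7 : ∀ x, (gaussianReal 0 v).real (Set.Iic (w - x))
        = (gaussianReal 0 v).real (Set.Iic 0) + (2 * Real.pi)⁻¹ * ∫ t, cdfKernel v (w - x) t := by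
      intro x
      rw [← real_Iic_sub_real_Iic_eq hv]; ring
    simp_rw [h7]
    rw [integral_add (integrable_const _) (h6.const_mul _), integral_const_mul,
      integral_integral_swap h4]
    simp_rw [e]
    simp

/-- Fourier bound for the difference of two distribution functions smoothed by a centred normal
law of variance `v`. -/
lemma ofReal_abs_smoothed_sub_le {v : ℝ≥0} (hv : v ≠ 0) (hP : Integrable (fun x => x) P)
    (hQ : Integrable (fun x => x) Q) (w : ℝ) :
    ENNReal.ofReal |∫ x, (gaussianReal 0 v).real (Set.Iic (w - x)) ∂P
        - ∫ x, (gaussianReal 0 v).real (Set.Iic (w - x)) ∂Q|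
      ≤ ∫⁻ t : ℝ, ENNReal.ofReal
          (Real.exp (-(v / 2 : ℝ) * t ^ 2) * (‖charFun P t - charFun Q t‖ / |t|)) := by
  obtain ⟨iP, eP⟩ := integral_real_Iic_sub_eq hv hP w
  obtain ⟨iQ, eQ⟩ := integral_real_Iic_sub_eq hv hQ w
  rw [eP, eQ, add_sub_add_left_eq_sub, ← mul_sub, ← integral_sub iP iQ, abs_mul]
  have hpi : |(2 * Real.pi)⁻¹| ≤ 1 := by
    rw [abs_of_pos (by positivity)]
    exact inv_le_one_of_one_le₀ (by linarith [Real.pi_gt_three])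
  refine (ENNReal.ofReal_le_ofReal (mul_le_of_le_one_left (abs_nonneg _) hpi)).trans ?_
  rw [← Real.norm_eq_abs, ofReal_norm]
  refine (enorm_integral_le_lintegral_enorm _).trans (lintegral_mono fun t => ?_)
  rw [← ofReal_norm]
  refine ENNReal.ofReal_le_ofReal ?_
  rw [← mul_sub, ← sub_div, norm_mul, norm_div, Real.norm_of_nonneg (Real.exp_nonneg _),
    Real.norm_eq_abs t]
  gcongr
  rw [integral_sin_eq_im, integral_sin_eq_im, ← Complex.sub_im, ← mul_sub]
  refine (Complex.abs_im_le_norm _).trans ?_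
  rw [norm_mul, Complex.norm_exp_ofReal_mul_I, one_mul, charFun_neg, charFun_neg, ← map_sub,
    RCLike.norm_conj]

lemma integral_real_Iic_sub_comm (ν : Measure ℝ) [IsProbabilityMeasure ν] (w : ℝ) :
    ∫ x, ν.real (Set.Iic (w - x)) ∂P = ∫ y, P.real (Set.Iic (w - y)) ∂ν := by
  have hA : MeasurableSet {p : ℝ × ℝ | p.1 + p.2 ≤ w} :=
    measurableSet_le (by fun_prop) (by fun_prop)
  have key : ∀ (α β : Measure ℝ) [IsProbabilityMeasure α] [IsProbabilityMeasure β],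
      ∫ x, β.real (Set.Iic (w - x)) ∂α = (∫⁻ x, β (Set.Iic (w - x)) ∂α).toReal := by
    intro α β _ _
    have hm : Measurable fun x => β (Set.Iic (w - x)) := by
      refine (Antitone.measurable fun a b hab => ?_)
      exact measure_mono (Set.Iic_subset_Iic.2 (by linarith))
    rw [← integral_toReal hm.aemeasurable (ae_of_all _ fun x => measure_lt_top _ _)]
    rfl
  rw [key P ν, key ν P]
  congr 1
  have h1 := Measure.prod_apply (μ := P) (ν := ν) hA
  have h2 := Measure.prod_apply_symm (μ := P) (ν := ν) hA
  have e1 : ∀ x : ℝ, Prod.mk x ⁻¹' {p : ℝ × ℝ | p.1 + p.2 ≤ w} = Set.Iic (w - x) := by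
    intro x; ext y; simp [le_sub_iff_add_le, add_comm]
  have e2 : ∀ y : ℝ, (fun x => (x, y)) ⁻¹' {p : ℝ × ℝ | p.1 + p.2 ≤ w} = Set.Iic (w - y) := by
    intro y; ext x; simp [le_sub_iff_add_le]
  simp_rw [e1] at h1
  simp_rw [e2] at h2
  rw [← h1, h2]

lemma abs_real_Iic_sub_le_one (t : ℝ) :
    |P.real (Set.Iic t) - Q.real (Set.Iic t)| ≤ 1 := by
  rw [abs_le]
  have h1 : P.real (Set.Iic t) ≤ 1 := measureReal_le_one
  have h2 : Q.real (Set.Iic t) ≤ 1 := measureReal_le_one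
  have h3 : 0 ≤ P.real (Set.Iic t) := measureReal_nonneg
  have h4 : 0 ≤ Q.real (Set.Iic t) := measureReal_nonneg
  constructor <;> linarith

variable (P Q) in
lemma bddAbove_range_abs_real_Iic_sub :
    BddAbove (Set.range fun t => |P.real (Set.Iic t) - Q.real (Set.Iic t)|) :=
  ⟨1, by rintro _ ⟨t, rfl⟩; exact abs_real_Iic_sub_le_one t⟩

omit [IsProbabilityMeasure P] [IsProbabilityMeasure Q] in
lemma kolmogorovDist_nonneg : 0 ≤ kolmogorovDist P Q :=
  Real.iSup_nonneg fun _ => abs_nonneg _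

lemma kolmogorovDist_le_one : kolmogorovDist P Q ≤ 1 :=
  ciSup_le abs_real_Iic_sub_le_one

lemma gaussianReal_real_Iic_sub_le {a b : ℝ} (hab : a ≤ b) :
    (gaussianReal 0 1).real (Set.Iic b) - (gaussianReal 0 1).real (Set.Iic a) ≤ b - a := by
  have h1 : (gaussianReal 0 1).real (Set.Iic b) - (gaussianReal 0 1).real (Set.Iic a)
      = (gaussianReal 0 1).real (Set.Ioc a b) := by
    have : Set.Ioc a b = Set.Iic b \ Set.Iic a := by ext; simp [and_comm]
    rw [this, measureReal_sdiff (Set.Iic_subset_Iic.2 hab) measurableSet_Iic]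
  rw [h1, measureReal_def]
  refine ENNReal.toReal_le_of_le_ofReal (by linarith) ?_
  rw [gaussianReal_apply _ one_ne_zero, ← Real.volume_Ioc, ← setLIntegral_one]
  refine lintegral_mono fun x => ?_
  rw [gaussianPDF]
  refine ENNReal.ofReal_le_one.2 ?_
  rw [gaussianPDFReal]
  have h2 : (√(2 * Real.pi * ((1 : ℝ≥0) : ℝ)))⁻¹ ≤ 1 := by
    refine inv_le_one_of_one_le₀ (Real.one_le_sqrt.2 ?_)
    have := Real.pi_gt_three
    simp only [NNReal.coe_one]; linarith
  have h3 : Real.exp (-(x - 0) ^ 2 / (2 * ((1 : ℝ≥0) : ℝ))) ≤ 1 := by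
    refine Real.exp_le_one_iff.2 ?_
    have := sq_nonneg (x - 0)
    simp only [NNReal.coe_one]; linarith
  exact mul_le_one₀ h2 (Real.exp_nonneg _) h3

lemma three_quarters_le_gaussianReal {v : ℝ≥0} (hv : v ≠ 0) :
    3 / 4 ≤ (gaussianReal 0 v).real {y | |y| < 2 * √v} := by
  have hv' : (0 : ℝ) < v := by positivity
  have h := meas_ge_le_variance_div_sq (μ := gaussianReal 0 v) (X := fun x => x)
    (by exact_mod_cast memLp_id_gaussianReal (μ := 0) (v := v) 2) (c := 2 * √v) (by positivity)
  rw [variance_fun_id_gaussianReal, integral_id_gaussianReal] at h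
  have e : (v : ℝ) / (2 * √v) ^ 2 = 1 / 4 := by
    rw [mul_pow, Real.sq_sqrt hv'.le]; field_simp; norm_num
  rw [e] at h
  simp only [sub_zero] at h
  have h2 : (gaussianReal 0 v).real {y | 2 * √v ≤ |y|} ≤ 1 / 4 :=
    ENNReal.toReal_le_of_le_ofReal (by norm_num) h
  have h3 : {y : ℝ | |y| < 2 * √v} = {y | 2 * √v ≤ |y|}ᶜ := by ext; simp
  rw [h3, probReal_compl_eq_one_sub (measurableSet_le (by fun_prop) (by fun_prop))]
  linarith

/-- If a function is bounded below by `-Δ` everywhere and by `D - c` within two standard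
deviations, then so is, up to constants, its Gaussian average. -/
lemma le_of_integral_gaussianReal_le {v : ℝ≥0} (hv : v ≠ 0) {f : ℝ → ℝ} {D c Δ δ : ℝ}
    (hf : Integrable f (gaussianReal 0 v)) (hΔ : 0 ≤ Δ)
    (h1 : ∀ y, -Δ ≤ f y) (h2 : ∀ y, |y| < 2 * √v → D - c ≤ f y)
    (h : |∫ y, f y ∂(gaussianReal 0 v)| ≤ δ) : D ≤ 4 / 3 * δ + Δ / 3 + c := by
  have hδ : 0 ≤ δ := (abs_nonneg _).trans h
  rcases le_or_gt (D - c + Δ) 0 with h0 | h0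
  · linarith
  set A : Set ℝ := {y | |y| < 2 * √v} with hA
  have hAm : MeasurableSet A := measurableSet_lt (by fun_prop) (by fun_prop)
  have h3 : ∫ y, (-Δ + A.indicator (fun _ => D - c + Δ) y) ∂(gaussianReal 0 v)
      ≤ ∫ y, f y ∂(gaussianReal 0 v) := by
    refine integral_mono ((integrable_const _).add ((integrable_const _).indicator hAm)) hf ?_
    intro y
    by_cases hy : y ∈ A
    · simpa [hy] using h2 y hy
    · simpa [hy] using h1 y
  rw [integral_add (integrable_const _) ((integrable_const _).indicator hAm),
    integral_indicator_const _ hAm] at h3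
  simp only [integral_const, probReal_univ, smul_eq_mul, one_mul] at h3
  have h4 := three_quarters_le_gaussianReal hv
  have h5 := (abs_le.1 h).2
  have : 3 / 4 * (D - c + Δ) ≤ (gaussianReal 0 v).real A * (D - c + Δ) := by gcongr
  linarith

lemma integrable_real_Iic_sub (ν : Measure ℝ) [IsProbabilityMeasure ν] (w : ℝ) :
    Integrable (fun y => P.real (Set.Iic (w - y))) ν := by
  have hm : Measurable fun y => P.real (Set.Iic (w - y)) :=
    (Antitone.measurable fun a b hab => measureReal_mono (Set.Iic_subset_Iic.2 (by linarith)))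
  refine (integrable_const (1 : ℝ)).mono' hm.aestronglyMeasurable (ae_of_all _ fun y => ?_)
  rw [Real.norm_of_nonneg measureReal_nonneg]
  exact measureReal_le_one

/-- Unsmoothing: the Kolmogorov distance to the standard normal law is controlled by the distance
after convolution with a centred normal law, up to the standard deviation of the latter. -/
lemma kolmogorovDist_le_of_smoothed_le {v : ℝ≥0} (hv : v ≠ 0) {δ : ℝ}
    (h : ∀ w, |∫ y, P.real (Set.Iic (w - y)) ∂(gaussianReal 0 v)
      - ∫ y, (gaussianReal 0 1).real (Set.Iic (w - y)) ∂(gaussianReal 0 v)| ≤ δ) :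
    kolmogorovDist P (gaussianReal 0 1) ≤ 2 * δ + 6 * √v := by
  set Q := gaussianReal 0 1 with hQ
  set Δ := kolmogorovDist P Q with hΔ
  have hb := bddAbove_range_abs_real_Iic_sub P Q
  have hle : ∀ t, |P.real (Set.Iic t) - Q.real (Set.Iic t)| ≤ Δ := fun t => le_ciSup hb t
  have hΔ0 : 0 ≤ Δ := kolmogorovDist_nonneg
  have hs : 0 ≤ √(v : ℝ) := Real.sqrt_nonneg _
  have hint : ∀ w, Integrable (fun y => P.real (Set.Iic (w - y)) - Q.real (Set.Iic (w - y)))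
      (gaussianReal 0 v) := fun w =>
    (integrable_real_Iic_sub _ w).sub (integrable_real_Iic_sub _ w)
  have h' : ∀ w, |∫ y, (P.real (Set.Iic (w - y)) - Q.real (Set.Iic (w - y))) ∂(gaussianReal 0 v)|
      ≤ δ := by
    intro w
    rw [integral_sub (integrable_real_Iic_sub _ w) (integrable_real_Iic_sub _ w)]
    exact h w
  have key : Δ ≤ 4 / 3 * δ + Δ / 3 + 4 * √v := by
    refine ciSup_le fun x => abs_le'.2 ⟨?_, ?_⟩
    -- Shifting `x` by two standard deviations turns the smoothed difference at the shifted point into a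
    -- one-sided bound at `x`, as the first distribution function is monotone and the second Lipschitz.
    · refine le_of_integral_gaussianReal_le hv (hint (x + 2 * √v)) hΔ0
        (fun y => (abs_le.1 (hle _)).1) (fun y hy => ?_) (h' (x + 2 * √v))
      have hy' := abs_lt.1 hy
      have m1 : P.real (Set.Iic x) ≤ P.real (Set.Iic (x + 2 * √v - y)) :=
        measureReal_mono (Set.Iic_subset_Iic.2 (by linarith))
      have m2 := gaussianReal_real_Iic_sub_le (show x ≤ x + 2 * √v - y by linarith)
      rw [← hQ] at m2
      linarith
    · have hi := (hint (x - 2 * √v)).neg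
      refine le_of_integral_gaussianReal_le hv hi hΔ0
        (fun y => ?_) (fun y hy => ?_) ?_ (δ := δ)
      · have := (abs_le.1 (hle (x - 2 * √v - y))).2
        simp only [Pi.neg_apply]; linarith
      · have hy' := abs_lt.1 hy
        have m1 : P.real (Set.Iic (x - 2 * √v - y)) ≤ P.real (Set.Iic x) :=
          measureReal_mono (Set.Iic_subset_Iic.2 (by linarith))
        have m2 := gaussianReal_real_Iic_sub_le (show x - 2 * √v - y ≤ x by linarith)
        rw [← hQ] at m2
        simp only [Pi.neg_apply]; linarith
      · simp only [Pi.neg_apply, integral_neg, abs_neg]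
        exact h' _
  linarith

/-- Esseen's smoothing inequality with a Gaussian kernel. -/
theorem ofReal_kolmogorovDist_le {v : ℝ≥0} (hv : v ≠ 0) (hP : Integrable (fun x => x) P) :
    ENNReal.ofReal (kolmogorovDist P (gaussianReal 0 1))
      ≤ 2 * (∫⁻ t : ℝ, ENNReal.ofReal (Real.exp (-(v / 2 : ℝ) * t ^ 2) *
          (‖charFun P t - Real.exp (-t ^ 2 / 2)‖ / |t|))) + ENNReal.ofReal (6 * √v) := by
  have hchar : ∀ t : ℝ, charFun (gaussianReal 0 1) t = (Real.exp (-t ^ 2 / 2) : ℝ) := by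
    intro t; rw [charFun_gaussianReal]; push_cast; congr 1; simp [neg_div]
  have hQ : Integrable (fun x => x) (gaussianReal 0 1) :=
    (memLp_id_gaussianReal (μ := 0) (v := 1) 1).integrable le_rfl
  set I := ∫⁻ t : ℝ, ENNReal.ofReal (Real.exp (-(v / 2 : ℝ) * t ^ 2) *
          (‖charFun P t - Real.exp (-t ^ 2 / 2)‖ / |t|)) with hI
  -- If the integral diverges there is nothing to prove.
  rcases eq_or_ne I ⊤ with h | h
  · rw [h]; simp
  have h1 := fun w => ofReal_abs_smoothed_sub_le hv hP hQ w
  simp_rw [hchar] at h1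
  rw [← hI] at h1
  have h2 := kolmogorovDist_le_of_smoothed_le (P := P) hv (δ := I.toReal) (fun w => by
    rw [← integral_real_Iic_sub_comm (P := P),
      ← integral_real_Iic_sub_comm (P := gaussianReal 0 1)]
    exact (ENNReal.ofReal_le_iff_le_toReal h).1 (h1 w))
  calc ENNReal.ofReal (kolmogorovDist P (gaussianReal 0 1))
      ≤ ENNReal.ofReal (2 * I.toReal + 6 * √v) := ENNReal.ofReal_le_ofReal h2
    _ ≤ 2 * I + ENNReal.ofReal (6 * √v) := by
      rw [ENNReal.ofReal_add (by positivity) (by positivity), ENNReal.ofReal_mul (by norm_num),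
        ENNReal.ofReal_toReal h]
      simp

end Smoothing

/-! ### Polar decomposition of the standard Gaussian and moments on the sphere -/

section Polar

variable {n : ℕ}

lemma lintegral_uniformSphere {G : EuclideanSpace ℝ (Fin n) → ℝ≥0∞} (hG : Measurable G) :
    ∫⁻ u, G u ∂(uniformSphere n)
      = ((volume : Measure (EuclideanSpace ℝ (Fin n))).toSphere Set.univ)⁻¹ *
        ∫⁻ u, G u ∂(volume : Measure (EuclideanSpace ℝ (Fin n))).toSphere := by
  rw [uniformSphere, lintegral_map hG measurable_subtype_coe, lintegral_smul_measure]
  rfl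

lemma toSphere_univ_ne_zero (hn : 0 < n) :
    (volume : Measure (EuclideanSpace ℝ (Fin n))).toSphere Set.univ ≠ 0 := by
  have : Nonempty (Fin n) := ⟨⟨0, hn⟩⟩
  rw [Ne, Measure.measure_univ_eq_zero]
  exact Measure.toSphere_ne_zero _

lemma isProbabilityMeasure_uniformSphere (hn : 0 < n) : IsProbabilityMeasure (uniformSphere n) := by
  constructor
  have h := lintegral_uniformSphere (n := n) (G := fun _ => 1) measurable_const
  rw [lintegral_one, lintegral_one] at h
  rw [h, ENNReal.inv_mul_cancel (toSphere_univ_ne_zero hn) (measure_ne_top _ _)]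

lemma ae_norm_eq_one_uniformSphere : ∀ᵐ u ∂(uniformSphere n), ‖u‖ = 1 := by
  rw [uniformSphere, ae_map_iff measurable_subtype_coe.aemeasurable
    (measurableSet_eq_fun (by fun_prop) (by fun_prop))]
  exact ae_of_all _ fun x => by simp

/-- Integration in polar coordinates, the angular variable being uniform on the sphere. -/
lemma lintegral_polar (hn : 0 < n) {H : EuclideanSpace ℝ (Fin n) → ℝ≥0∞} (hH : Measurable H) :
    ∫⁻ x, H x = (volume : Measure (EuclideanSpace ℝ (Fin n))).toSphere Set.univ *
      ∫⁻ r : Set.Ioi (0 : ℝ), ∫⁻ u, H ((r : ℝ) • u) ∂(uniformSphere n)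
        ∂(Measure.volumeIoiPow (Module.finrank ℝ (EuclideanSpace ℝ (Fin n)) - 1)) := by
  have : Nonempty (Fin n) := ⟨⟨0, hn⟩⟩
  set ω := (volume : Measure (EuclideanSpace ℝ (Fin n))).toSphere Set.univ with hω
  have h1 : ∫⁻ x, H x = ∫⁻ x : ({0}ᶜ : Set (EuclideanSpace ℝ (Fin n))), H x.1 ∂(Measure.comap Subtype.val volume) := by
    rw [lintegral_subtype_comap (measurableSet_singleton _).compl, restrict_compl_singleton]
  have h2 := ((volume : Measure (EuclideanSpace ℝ (Fin n))).measurePreserving_homeomorphUnitSphereProd).lintegral_comp_emb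
    (Homeomorph.measurableEmbedding _) (fun p => H ((p.2 : ℝ) • (p.1 : (EuclideanSpace ℝ (Fin n)))))
  have h3 : ∀ x : ({0}ᶜ : Set (EuclideanSpace ℝ (Fin n))), H (((homeomorphUnitSphereProd (EuclideanSpace ℝ (Fin n)) x).2 : ℝ) •
      ((homeomorphUnitSphereProd (EuclideanSpace ℝ (Fin n)) x).1 : (EuclideanSpace ℝ (Fin n)))) = H x := by
    intro x
    rw [← homeomorphUnitSphereProd_symm_apply_coe, Homeomorph.symm_apply_apply]
  simp_rw [h3] at h2
  have hm : Measurable fun p : Metric.sphere (0 : (EuclideanSpace ℝ (Fin n))) 1 × Set.Ioi (0 : ℝ) =>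
      H ((p.2 : ℝ) • (p.1 : (EuclideanSpace ℝ (Fin n)))) := by fun_prop
  rw [h1, h2, lintegral_prod_symm _ hm.aemeasurable]
  have hm2 : ∀ r : ℝ, Measurable fun u : (EuclideanSpace ℝ (Fin n)) => H (r • u) := fun r => by fun_prop
  rw [← lintegral_const_mul']
  · refine lintegral_congr fun r => ?_
    rw [lintegral_uniformSphere (hm2 r), ← mul_assoc,
      ENNReal.mul_inv_cancel (toSphere_univ_ne_zero hn) (measure_ne_top _ _), one_mul]
  · exact measure_ne_top _ _

/-- The standard Gaussian has, up to normalisation, density `e^{-‖x‖²/2}`. -/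
lemma exists_withDensity_eq_smul_stdGaussian :
    ∃ c : ℝ≥0∞, c ≠ 0 ∧ c ≠ ⊤ ∧
      (volume : Measure (EuclideanSpace ℝ (Fin n))).withDensity
        (fun x => ENNReal.ofReal (Real.exp (-‖x‖ ^ 2 / 2)))
        = c • stdGaussian (EuclideanSpace ℝ (Fin n)) := by
  have hint : Integrable (fun x : (EuclideanSpace ℝ (Fin n)) => Real.exp (-‖x‖ ^ 2 / 2)) := by
    have h := (GaussianFourier.integrable_cexp_neg_mul_sq_norm_add (V := (EuclideanSpace ℝ (Fin n))) (b := (1 / 2 : ℂ))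
      (by norm_num) 0 0).norm
    refine h.congr (ae_of_all _ fun x => ?_)
    simp only [zero_mul, add_zero, Complex.norm_exp]
    congr 1
    have : (-(1 / 2 : ℂ) * (‖x‖ : ℂ) ^ 2) = ((-‖x‖ ^ 2 / 2 : ℝ) : ℂ) := by push_cast; ring
    rw [this, Complex.ofReal_re]
  set M := (volume : Measure (EuclideanSpace ℝ (Fin n))).withDensity (fun x => ENNReal.ofReal (Real.exp (-‖x‖ ^ 2 / 2)))
  have : IsFiniteMeasure M := isFiniteMeasure_withDensity_ofReal hint.2
  let K : ℝ := (2 * Real.pi) ^ ((n : ℝ) / 2)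
  have hK : 0 < K := by positivity
  refine ⟨ENNReal.ofReal K, by simpa using hK, ENNReal.ofReal_ne_top, ?_⟩
  have : IsFiniteMeasure (ENNReal.ofReal K • stdGaussian (EuclideanSpace ℝ (Fin n))) :=
    Measure.smul_finite _ ENNReal.ofReal_ne_top
  refine Measure.ext_of_charFun ?_
  ext t
  rw [charFun_apply, charFun_apply, integral_smul_measure,
    ← charFun_apply (μ := stdGaussian (EuclideanSpace ℝ (Fin n))), charFun_stdGaussian,
    integral_withDensity_eq_integral_toReal_smul (by fun_prop)
      (ae_of_all _ fun _ => ENNReal.ofReal_lt_top)]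
  have h := GaussianFourier.integral_cexp_neg_mul_sq_norm_add (V := (EuclideanSpace ℝ (Fin n))) (b := (1 / 2 : ℂ))
    (by norm_num) Complex.I t
  have e1 : ∀ x : (EuclideanSpace ℝ (Fin n)), (ENNReal.ofReal (Real.exp (-‖x‖ ^ 2 / 2))).toReal •
      Complex.exp (⟪x, t⟫ * Complex.I)
      = Complex.exp (-(1 / 2 : ℂ) * (‖x‖ : ℂ) ^ 2 + Complex.I * ⟪t, x⟫) := by
    intro x
    rw [ENNReal.toReal_ofReal (Real.exp_nonneg _), Complex.real_smul, Complex.ofReal_exp,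
      ← Complex.exp_add, real_inner_comm]
    congr 1
    push_cast
    ring
  simp_rw [e1]
  rw [h, ENNReal.toReal_ofReal hK.le, Complex.real_smul]
  congr 1
  · have : ((Real.pi : ℂ) / (1 / 2)) = ((2 * Real.pi : ℝ) : ℂ) := by push_cast; ring
    rw [this]
    simp only [K]
    rw [Complex.ofReal_cpow (by positivity)]
    congr 1
    simp
  · congr 1
    rw [Complex.I_sq]; ring

/-- Under the standard Gaussian the direction is uniform on the sphere and independent of the
norm. -/
theorem lintegral_stdGaussian_eq (hn : 0 < n) {F : EuclideanSpace ℝ (Fin n) → ℝ≥0∞}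
    (hF : Measurable F) :
    ∫⁻ x, F x ∂(stdGaussian (EuclideanSpace ℝ (Fin n)))
      = ∫⁻ x, ∫⁻ u, F (‖x‖ • u) ∂(uniformSphere n)
          ∂(stdGaussian (EuclideanSpace ℝ (Fin n))) := by
  have := isProbabilityMeasure_uniformSphere hn
  obtain ⟨c, hc0, hct, hc⟩ := exists_withDensity_eq_smul_stdGaussian (n := n)
  have key : ∀ G : (EuclideanSpace ℝ (Fin n)) → ℝ≥0∞, Measurable G → c * ∫⁻ x, G x ∂(stdGaussian (EuclideanSpace ℝ (Fin n)))
      = (volume : Measure (EuclideanSpace ℝ (Fin n))).toSphere Set.univ *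
      ∫⁻ r : Set.Ioi (0 : ℝ), ENNReal.ofReal (Real.exp (-(r : ℝ) ^ 2 / 2)) *
        ∫⁻ u, G ((r : ℝ) • u) ∂(uniformSphere n)
        ∂(Measure.volumeIoiPow (Module.finrank ℝ (EuclideanSpace ℝ (Fin n)) - 1)) := by
    intro G hG
    have h1 := lintegral_smul_measure (μ := stdGaussian (EuclideanSpace ℝ (Fin n))) c G
    rw [smul_eq_mul] at h1
    rw [← h1, ← hc, lintegral_withDensity_eq_lintegral_mul _ (by fun_prop) hG,
      lintegral_polar hn (by fun_prop)]
    congr 1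
    refine lintegral_congr fun r => ?_
    rw [← lintegral_const_mul _ (by fun_prop)]
    refine lintegral_congr_ae ?_
    filter_upwards [ae_norm_eq_one_uniformSphere] with u hu
    simp only [Pi.mul_apply, norm_smul, hu, Real.norm_eq_abs, mul_one, sq_abs]
  have hA : Measurable fun r : ℝ => ∫⁻ u, F (r • u) ∂(uniformSphere n) := by
    refine Measurable.lintegral_prod_right' (f := fun p : ℝ × (EuclideanSpace ℝ (Fin n)) => F (p.1 • p.2)) ?_
    fun_prop
  have h1 := key F hF
  have h2 := key (fun x => ∫⁻ u, F (‖x‖ • u) ∂(uniformSphere n)) (hA.comp measurable_norm)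
  have h3 : c * ∫⁻ x, F x ∂(stdGaussian (EuclideanSpace ℝ (Fin n)))
      = c * ∫⁻ x, ∫⁻ u, F (‖x‖ • u) ∂(uniformSphere n) ∂(stdGaussian (EuclideanSpace ℝ (Fin n))) := by
    rw [h1, h2]
    congr 1
    refine lintegral_congr fun r => ?_
    congr 1
    have hr : (0 : ℝ) < r := r.2
    have : ∀ᵐ u ∂(uniformSphere n), ∫⁻ u', F (‖(r : ℝ) • u‖ • u') ∂(uniformSphere n)
        = ∫⁻ u', F ((r : ℝ) • u') ∂(uniformSphere n) := by
      filter_upwards [ae_norm_eq_one_uniformSphere] with u hu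
      rw [norm_smul, hu, mul_one, Real.norm_of_nonneg hr.le]
    rw [lintegral_congr_ae this]
    simp
  exact (ENNReal.mul_right_inj hc0 hct).1 h3

end Polar

section Moments

lemma integral_sq_gaussianReal : ∫ x, x ^ 2 ∂(gaussianReal 0 1) = 1 := by
  have h := variance_fun_id_gaussianReal (μ := 0) (v := 1)
  rw [variance_eq_integral (by fun_prop), integral_id_gaussianReal] at h
  simpa using h

lemma integral_pow_four_gaussianReal : ∫ x, x ^ 4 ∂(gaussianReal 0 1) = 3 := by
  have h1 : ∫ x, x ^ 4 ∂(gaussianReal 0 1)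
      = iteratedDeriv 4 (mgf (fun x => x) (gaussianReal 0 1)) 0 := by
    rw [iteratedDeriv_mgf_zero] <;> simp
  rw [h1, mgf_fun_id_gaussianReal]
  simp only [zero_mul, zero_add, NNReal.coe_one, one_mul]
  have hexp : ∀ t : ℝ, HasDerivAt (fun t : ℝ => Real.exp (t ^ 2 / 2)) (t * Real.exp (t ^ 2 / 2)) t := by
    intro t
    have := ((hasDerivAt_pow 2 t).div_const 2).exp
    convert this using 1
    simp; ring
  have step : ∀ (p q : ℝ → ℝ), (∀ t, HasDerivAt p (q t - t * p t) t) →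
      deriv (fun t => p t * Real.exp (t ^ 2 / 2)) = fun t => q t * Real.exp (t ^ 2 / 2) := by
    intro p q hp
    ext t
    rw [((hp t).fun_mul (hexp t)).deriv]
    ring
  have d1 : deriv (fun t : ℝ => Real.exp (t ^ 2 / 2)) = fun t => t * Real.exp (t ^ 2 / 2) := by
    ext t; exact (hexp t).deriv
  have d2 := step (fun t => t) (fun t => 1 + t ^ 2) (fun t =>
    (hasDerivAt_id' t).congr_deriv (by ring))
  have d3 := step (fun t => 1 + t ^ 2) (fun t => 3 * t + t ^ 3) (fun t =>
    ((hasDerivAt_pow 2 t).const_add 1).congr_deriv (by push_cast; ring))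
  have d4 := step (fun t => 3 * t + t ^ 3) (fun t => 3 + 6 * t ^ 2 + t ^ 4) (fun t =>
    (((hasDerivAt_id' t).const_mul 3).fun_add (hasDerivAt_pow 3 t)).congr_deriv
      (by push_cast; ring))
  simp only [iteratedDeriv_succ, iteratedDeriv_zero]
  rw [d1, d2, d3, d4]
  simp

variable {n : ℕ}

/-- Mean and variance of a diagonal quadratic form in independent standard Gaussians. -/
lemma mean_variance_sum_mul_sq_stdGaussian (c : Fin n → ℝ) :
    MemLp (fun x : EuclideanSpace ℝ (Fin n) => ∑ j, c j * x j ^ 2) 2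
      (stdGaussian (EuclideanSpace ℝ (Fin n))) ∧
    ∫ x, ∑ j, c j * x j ^ 2 ∂(stdGaussian (EuclideanSpace ℝ (Fin n))) = ∑ j, c j ∧
    Var[fun x => ∑ j, c j * x j ^ 2; stdGaussian (EuclideanSpace ℝ (Fin n))]
      = 2 * ∑ j, c j ^ 2 := by
  have h4 : MemLp (fun x : ℝ => x) 4 (gaussianReal 0 1) := by
    exact_mod_cast memLp_id_gaussianReal (μ := 0) (v := 1) 4
  have hsq : MemLp (fun x : ℝ => x ^ 2) 2 (gaussianReal 0 1) := by
    have h := h4.norm_rpow_div (q := 2)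
    have e : (4 : ℝ≥0∞) / 2 = 2 := by
      rw [← ENNReal.toReal_eq_toReal_iff' (by finiteness) (by finiteness)]
      norm_num
    rw [e] at h
    simpa using h
  have hvar : Var[fun x : ℝ => x ^ 2; gaussianReal 0 1] = 2 := by
    rw [variance_eq_sub hsq]
    have : ∫ x, ((fun x : ℝ => x ^ 2) ^ 2) x ∂(gaussianReal 0 1) = 3 := by
      rw [← integral_pow_four_gaussianReal]
      refine integral_congr_ae (ae_of_all _ fun x => ?_)
      simp; ring
    rw [this, integral_sq_gaussianReal]; norm_num
  set π := Measure.pi (fun _ : Fin n => gaussianReal 0 1) with hπ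
  have hmem : ∀ j, MemLp (fun x : Fin n → ℝ => c j * x j ^ 2) 2 π := fun j =>
    (hsq.comp_measurePreserving (measurePreserving_eval (fun _ : Fin n => gaussianReal 0 1) j)).const_mul _
  have hmemS : MemLp (fun x : Fin n → ℝ => ∑ j, c j * x j ^ 2) 2 π :=
    memLp_finsetSum _ fun j _ => hmem j
  have hmean : ∫ x : Fin n → ℝ, ∑ j, c j * x j ^ 2 ∂π = ∑ j, c j := by
    rw [integral_finsetSum _ fun j _ => (hmem j).integrable (by norm_num)]
    refine Finset.sum_congr rfl fun j _ => ?_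
    rw [integral_const_mul]
    have := integral_comp_eval (μ := fun _ : Fin n => gaussianReal 0 1) (i := j)
      (f := fun x : ℝ => x ^ 2) (by fun_prop)
    rw [this, integral_sq_gaussianReal, mul_one]
  have hV : Var[fun x : Fin n → ℝ => ∑ j, c j * x j ^ 2; π] = 2 * ∑ j, c j ^ 2 := by
    have h := variance_sum_pi (μ := fun _ : Fin n => gaussianReal 0 1)
      (X := fun j x => c j * x ^ 2) (fun j => hsq.const_mul _)
    have e : (fun x : Fin n → ℝ => ∑ j, c j * x j ^ 2) = ∑ j, fun x : Fin n → ℝ => c j * x j ^ 2 := by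
      ext x; simp
    rw [e, h, Finset.mul_sum]
    refine Finset.sum_congr rfl fun j _ => ?_
    rw [variance_const_mul, hvar]; ring
  have hm : MeasurableEmbedding (WithLp.toLp 2 : (Fin n → ℝ) → EuclideanSpace ℝ (Fin n)) :=
    (MeasurableEquiv.toLp 2 _).measurableEmbedding
  rw [← map_pi_eq_stdGaussian]
  refine ⟨hm.memLp_map_measure_iff.2 hmemS, ?_, ?_⟩
  · rw [hm.integral_map]
    exact hmean
  · rw [variance_map (by fun_prop) hm.measurable.aemeasurable]
    exact hV

lemma integral_sum_sq_mul_sq_stdGaussian (c : Fin n → ℝ) :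
    ∫ x, (∑ j, c j * x j ^ 2) ^ 2 ∂(stdGaussian (EuclideanSpace ℝ (Fin n)))
      = (∑ j, c j) ^ 2 + 2 * ∑ j, c j ^ 2 := by
  obtain ⟨h1, h2, h3⟩ := mean_variance_sum_mul_sq_stdGaussian c
  have := variance_eq_sub h1
  rw [h2, h3] at this
  simp only [Pi.pow_apply] at this
  linarith

/-- The spherical second moment of a diagonal quadratic form: the radial part of the Gaussian
identity factors out, and has fourth moment `n² + 2n ≥ n²`. -/
lemma lintegral_sum_sq_mul_sq_uniformSphere_le (hn : 0 < n) (c : Fin n → ℝ) :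
    ∫⁻ u, ENNReal.ofReal ((∑ j, c j * u j ^ 2) ^ 2) ∂(uniformSphere n)
      ≤ ENNReal.ofReal (((∑ j, c j) ^ 2 + 2 * ∑ j, c j ^ 2) / n ^ 2) := by
  have hn' : (0 : ℝ) < n := by exact_mod_cast hn
  have key : ∀ a : Fin n → ℝ,
      ∫⁻ x, ENNReal.ofReal ((∑ j, a j * x j ^ 2) ^ 2) ∂(stdGaussian (EuclideanSpace ℝ (Fin n)))
      = ENNReal.ofReal ((∑ j, a j) ^ 2 + 2 * ∑ j, a j ^ 2) := by
    intro a
    rw [← ofReal_integral_eq_lintegral_ofReal (mean_variance_sum_mul_sq_stdGaussian a).1.integrable_sq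
      (ae_of_all _ fun x => sq_nonneg _), integral_sum_sq_mul_sq_stdGaussian]
  have h1 := key c
  have h2 := key (fun _ => 1)
  have e2 : ∀ x : EuclideanSpace ℝ (Fin n), (∑ j, (1 : ℝ) * x j ^ 2) ^ 2 = ‖x‖ ^ 4 := by
    intro x
    simp only [one_mul]
    rw [← EuclideanSpace.real_norm_sq_eq]; ring
  simp_rw [e2] at h2
  rw [lintegral_stdGaussian_eq hn (by fun_prop)] at h1
  have e1 : ∀ x : EuclideanSpace ℝ (Fin n),
      ∫⁻ u, ENNReal.ofReal ((∑ j, c j * (‖x‖ • u) j ^ 2) ^ 2) ∂(uniformSphere n)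
      = ENNReal.ofReal (‖x‖ ^ 4) *
        ∫⁻ u, ENNReal.ofReal ((∑ j, c j * u j ^ 2) ^ 2) ∂(uniformSphere n) := by
    intro x
    rw [← lintegral_const_mul _ (by fun_prop)]
    refine lintegral_congr fun u => ?_
    rw [← ENNReal.ofReal_mul (by positivity)]
    congr 1
    have : ∑ j, c j * (‖x‖ • u) j ^ 2 = ‖x‖ ^ 2 * ∑ j, c j * u j ^ 2 := by
      rw [Finset.mul_sum]
      refine Finset.sum_congr rfl fun j _ => ?_
      simp only [PiLp.smul_apply, smul_eq_mul]; ring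
    rw [this]; ring
  simp_rw [e1] at h1
  rw [lintegral_mul_const _ (by fun_prop), h2] at h1
  simp only [Finset.sum_const, Finset.card_univ, Fintype.card_fin, nsmul_eq_mul, mul_one,
    one_pow] at h1
  rw [ENNReal.ofReal_div_of_pos (by positivity), ENNReal.le_div_iff_mul_le (by simp [hn.ne'])
    (by simp), ← h1, mul_comm]
  gcongr
  nlinarith

/-- Chebyshev's inequality for `‖x‖²`, which has mean `n` and variance `2n`. -/
lemma half_le_stdGaussian_norm (hn : 8 ≤ n) :
    2⁻¹ ≤ stdGaussian (EuclideanSpace ℝ (Fin n))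
      (norm ⁻¹' Set.Icc (√n / 2) (2 * √n)) := by
  have hn' : (8 : ℝ) ≤ n := by exact_mod_cast hn
  obtain ⟨h1, h2, h3⟩ := mean_variance_sum_mul_sq_stdGaussian (fun _ : Fin n => 1)
  have e : ∀ x : EuclideanSpace ℝ (Fin n), ∑ j, (1 : ℝ) * x j ^ 2 = ‖x‖ ^ 2 := by
    intro x
    simp only [one_mul]
    rw [← EuclideanSpace.real_norm_sq_eq]
  simp_rw [e] at h1 h2 h3
  simp only [Finset.sum_const, Finset.card_univ, Fintype.card_fin, nsmul_eq_mul, mul_one,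
    one_pow] at h2 h3
  have h := meas_ge_le_variance_div_sq h1 (c := 3 / 4 * n) (by positivity)
  rw [h2, h3] at h
  set A : Set (EuclideanSpace ℝ (Fin n)) := norm ⁻¹' Set.Icc (√n / 2) (2 * √n) with hA
  have hAm : MeasurableSet A := measurableSet_Icc.preimage measurable_norm
  have hsub : Aᶜ ⊆ {x | 3 / 4 * (n : ℝ) ≤ |‖x‖ ^ 2 - n|} := by
    intro x hx
    simp only [hA, Set.mem_compl_iff, Set.mem_preimage, Set.mem_Icc, Set.mem_ofPred_eq, not_and_or,
      not_le] at hx ⊢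
    have hs := Real.sq_sqrt (show (0 : ℝ) ≤ n by positivity)
    have hs0 : 0 ≤ √(n : ℝ) := Real.sqrt_nonneg _
    rw [le_abs]
    rcases hx with hx | hx
    · right
      have : ‖x‖ ^ 2 ≤ (√n / 2) ^ 2 := pow_le_pow_left₀ (norm_nonneg _) hx.le 2
      rw [div_pow, hs] at this
      linarith
    · left
      have : (2 * √n) ^ 2 ≤ ‖x‖ ^ 2 := pow_le_pow_left₀ (by positivity) hx.le 2
      rw [mul_pow, hs] at this
      linarith
  have h5 : stdGaussian (EuclideanSpace ℝ (Fin n)) Aᶜ ≤ 2⁻¹ := by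
    refine (measure_mono hsub).trans (h.trans ?_)
    rw [← ENNReal.ofReal_ofNat, ← ENNReal.ofReal_inv_of_pos (by norm_num)]
    refine ENNReal.ofReal_le_ofReal ?_
    rw [div_le_iff₀ (by positivity)]
    nlinarith
  have h6 : A = Aᶜᶜ := (compl_compl A).symm
  rw [h6, prob_compl_eq_one_sub hAm.compl, ← ENNReal.one_sub_inv_two]
  exact tsub_le_tsub_left h5 1

end Moments

/-! ### High frequencies -/

lemma lintegral_comp_mul_left_mul {ρ : ℝ} (hρ : 0 < ρ) {g : ℝ → ℝ≥0∞} (hg : Measurable g) :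
    ∫⁻ t, ENNReal.ofReal ρ * g (ρ * t) = ∫⁻ s, g s := by
  have h := Real.map_volume_mul_left hρ.ne'
  have h2 : ∫⁻ s, g s ∂(Measure.map (ρ * ·) volume) = ∫⁻ t, g (ρ * t) :=
    lintegral_map hg (measurable_const_mul ρ)
  rw [lintegral_const_mul _ (by fun_prop), ← h2, h, lintegral_smul_measure, smul_eq_mul,
    ← mul_assoc, abs_of_pos (inv_pos.2 hρ), ← ENNReal.ofReal_mul hρ.le, mul_inv_cancel₀ hρ.ne',
    ENNReal.ofReal_one, one_mul]

/-- Since `dt / |t|` is invariant under dilations and the norm of a standard Gaussian vector in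
dimension `n` is of order `√n` with probability at least `1 / 2`, a high-frequency integral over
the sphere is at most twice the corresponding Gaussian one. -/
lemma lintegral_uniformSphere_le_stdGaussian {n : ℕ} (hn : 8 ≤ n)
    {φ : EuclideanSpace ℝ (Fin n) → ℝ≥0∞} (hφ : Measurable φ) (b : ℝ) :
    ∫⁻ s in {s : ℝ | 2 * b ≤ |s|}, ENNReal.ofReal (Real.exp (-s ^ 2 / (2 * n)) / |s|) *
        ∫⁻ u, φ (s • u) ∂(uniformSphere n)
      ≤ 2 * ∫⁻ t in {t : ℝ | b ≤ |t|}, ENNReal.ofReal (Real.exp (-t ^ 2 / (8 * n)) / |t|) *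
        ∫⁻ x, φ ((t / √n) • x) ∂(stdGaussian (EuclideanSpace ℝ (Fin n))) := by
  have hn0 : 0 < n := by omega
  have hn' : (0 : ℝ) < n := by exact_mod_cast hn0
  have := isProbabilityMeasure_uniformSphere hn0
  set γ := stdGaussian (EuclideanSpace ℝ (Fin n)) with hγ
  set Φ : ℝ → ℝ≥0∞ := fun s => ∫⁻ u, φ (s • u) ∂(uniformSphere n) with hΦ
  have hΦm : Measurable Φ :=
    Measurable.lintegral_prod_right' (f := fun p : ℝ × EuclideanSpace ℝ (Fin n) => φ (p.1 • p.2))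
      (by fun_prop)
  set S : Set ℝ := {s : ℝ | 2 * b ≤ |s|} with hS
  set T : Set ℝ := {t : ℝ | b ≤ |t|} with hT
  have hSm : MeasurableSet S := measurableSet_le (by fun_prop) (by fun_prop)
  have hTm : MeasurableSet T := measurableSet_le (by fun_prop) (by fun_prop)
  set K : ℝ → ℝ≥0∞ := S.indicator fun s =>
    ENNReal.ofReal (Real.exp (-s ^ 2 / (2 * n)) / |s|) with hK
  set k : ℝ → ℝ≥0∞ := T.indicator fun t =>
    ENNReal.ofReal (Real.exp (-t ^ 2 / (8 * n)) / |t|) with hk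
  have hKm : Measurable K := Measurable.indicator (by fun_prop) hSm
  have hkm : Measurable k := Measurable.indicator (by fun_prop) hTm
  have eL : ∫⁻ s in S, ENNReal.ofReal (Real.exp (-s ^ 2 / (2 * n)) / |s|) * Φ s
      = ∫⁻ s, K s * Φ s := by
    rw [← lintegral_indicator hSm]
    refine lintegral_congr fun s => ?_
    by_cases hs : s ∈ S <;> simp [K, hs]
  have eR : ∫⁻ t in T, ENNReal.ofReal (Real.exp (-t ^ 2 / (8 * n)) / |t|) *
      ∫⁻ x, φ ((t / √n) • x) ∂γ = ∫⁻ x, (∫⁻ t, k t * Φ (‖x‖ / √n * t)) ∂γ := by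
    rw [← lintegral_indicator hTm, ← lintegral_lintegral_swap]
    · refine lintegral_congr fun t => ?_
      have : ∀ x : EuclideanSpace ℝ (Fin n),
          ∫⁻ u, φ ((t / √n) • ‖x‖ • u) ∂(uniformSphere n) = Φ (‖x‖ / √n * t) := by
        intro x
        simp only [hΦ, smul_smul]
        refine lintegral_congr fun u => ?_
        congr 2
        ring
      have h2 : ∫⁻ x, φ ((t / √n) • x) ∂γ = ∫⁻ x, Φ (‖x‖ / √n * t) ∂γ := by
        rw [hγ, lintegral_stdGaussian_eq hn0 (F := fun x => φ ((t / √n) • x)) (by fun_prop)]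
        exact lintegral_congr this
      rw [lintegral_const_mul _ (by fun_prop), ← h2]
      by_cases ht : t ∈ T <;> simp [k, ht]
    · exact Measurable.aemeasurable (by fun_prop)
  rw [eL, eR]
  set A : Set (EuclideanSpace ℝ (Fin n)) := norm ⁻¹' Set.Icc (√n / 2) (2 * √n) with hA
  have hAm : MeasurableSet A := measurableSet_Icc.preimage measurable_norm
  have hsq : 0 < √(n : ℝ) := Real.sqrt_pos.2 hn'
  -- For each `x` of norm about `√n`, substitute `s = (‖x‖ / √n) t`, a dilation by a factor between `1/2`
  -- and `2`.
  have hx : ∀ x ∈ A, ∫⁻ s, K s * Φ s ≤ ∫⁻ t, k t * Φ (‖x‖ / √n * t) := by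
    rintro x ⟨hx1, hx2⟩
    set ρ := ‖x‖ / √n with hρ
    have hρ1 : 1 / 2 ≤ ρ := by rw [hρ, le_div_iff₀ hsq]; linarith
    have hρ2 : ρ ≤ 2 := by rw [hρ, div_le_iff₀ hsq]; linarith
    rw [← lintegral_comp_mul_left_mul (show 0 < ρ by linarith)
      (show Measurable fun s => K s * Φ s by fun_prop)]
    refine lintegral_mono fun t => ?_
    rw [← mul_assoc]
    refine mul_le_mul_left ?_ _
    by_cases ht : ρ * t ∈ S
    · have ht2 : t ∈ T := by
        simp only [S, T, Set.mem_ofPred_eq, abs_mul, abs_of_pos (show 0 < ρ by linarith)] at ht ⊢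
        have : ρ * |t| ≤ 2 * |t| := by gcongr
        linarith
      simp only [K, k, ht, ht2, Set.indicator_of_mem]
      rw [← ENNReal.ofReal_mul (by linarith)]
      refine ENNReal.ofReal_le_ofReal ?_
      rw [abs_mul, abs_of_pos (show 0 < ρ by linarith)]
      have e : ρ * (Real.exp (-(ρ * t) ^ 2 / (2 * n)) / (ρ * |t|))
          = Real.exp (-(ρ * t) ^ 2 / (2 * n)) / |t| := by
        have : ρ ≠ 0 := by linarith
        rw [← mul_div_assoc, mul_div_mul_left _ _ this]
      rw [e]
      refine div_le_div_of_nonneg_right (Real.exp_le_exp.2 ?_) (abs_nonneg t)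
      rw [div_le_div_iff₀ (by positivity) (by positivity)]
      have h4 : (1 / 4 : ℝ) ≤ ρ ^ 2 := by nlinarith
      have h5 : 0 ≤ t ^ 2 * (n : ℝ) := by positivity
      nlinarith [mul_le_mul_of_nonneg_right h4 h5]
    · simp [K, ht]
  have h1 : γ A * ∫⁻ s, K s * Φ s ≤ ∫⁻ x, (∫⁻ t, k t * Φ (‖x‖ / √n * t)) ∂γ := by
    rw [mul_comm, ← setLIntegral_const]
    exact (setLIntegral_mono' hAm hx).trans (setLIntegral_le_lintegral _ _)
  have h2 : 2⁻¹ ≤ γ A := half_le_stdGaussian_norm hn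
  calc ∫⁻ s, K s * Φ s = 2 * (2⁻¹ * ∫⁻ s, K s * Φ s) := by
        rw [← mul_assoc, ENNReal.mul_inv_cancel (by norm_num) (by norm_num), one_mul]
    _ ≤ 2 * (γ A * ∫⁻ s, K s * Φ s) := by gcongr
    _ ≤ _ := by gcongr

section Symmetrization

variable {E : Type*} [NormedAddCommGroup E] [InnerProductSpace ℝ E] [FiniteDimensional ℝ E]
  [MeasurableSpace E] [BorelSpace E] {P : Measure E} [IsProbabilityMeasure P]

/-- Symmetrization: `|f|²` is the characteristic function of the difference of two independent copies,
and averaging the argument over a Gaussian evaluates the characteristic function of the latter. -/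
lemma integral_norm_charFun_smul_sq (τ : ℝ) :
    ∫ x, ‖charFun P (τ • x)‖ ^ 2 ∂(stdGaussian E)
      = ∫ p, Real.exp (-(τ ^ 2 * ‖p.1 - p.2‖ ^ 2) / 2) ∂(P.prod P) := by
  have h1 : ∀ v : E, ((‖charFun P v‖ ^ 2 : ℝ) : ℂ)
      = ∫ p, Complex.exp (⟪p.1 - p.2, v⟫ * Complex.I) ∂(P.prod P) := by
    intro v
    have e : ∀ p : E × E, Complex.exp (⟪p.1 - p.2, v⟫ * Complex.I)
        = Complex.exp (⟪p.1, v⟫ * Complex.I) * Complex.exp (⟪p.2, -v⟫ * Complex.I) := by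
      intro p
      rw [← Complex.exp_add, inner_sub_left, inner_neg_right]
      congr 1; push_cast; ring
    simp_rw [e]
    rw [integral_prod_mul (fun x : E => Complex.exp (⟪x, v⟫ * Complex.I))
      (fun y : E => Complex.exp (⟪y, -v⟫ * Complex.I)), ← charFun_apply, ← charFun_apply,
      charFun_neg, Complex.mul_conj, Complex.normSq_eq_norm_sq]
  have h2 : ((∫ x, ‖charFun P (τ • x)‖ ^ 2 ∂(stdGaussian E) : ℝ) : ℂ)
      = ((∫ p, Real.exp (-(τ ^ 2 * ‖p.1 - p.2‖ ^ 2) / 2) ∂(P.prod P) : ℝ) : ℂ) := by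
    rw [← integral_complex_ofReal, ← integral_complex_ofReal]
    simp_rw [h1]
    rw [integral_integral_swap]
    · refine integral_congr_ae (ae_of_all _ fun p => ?_)
      have e : ∀ x : E, Complex.exp (⟪p.1 - p.2, τ • x⟫ * Complex.I)
          = Complex.exp (⟪x, τ • (p.1 - p.2)⟫ * Complex.I) := by
        intro x; rw [real_inner_smul_right, real_inner_smul_right, real_inner_comm]
      simp only [e]
      rw [← charFun_apply, charFun_stdGaussian, norm_smul]
      push_cast
      congr 1
      rw [mul_pow, Real.norm_eq_abs, ← Complex.ofReal_pow |τ|, sq_abs]; push_cast; ring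
    · refine Integrable.mono' (integrable_const (1 : ℝ)) ?_
        (ae_of_all _ fun q => (Complex.norm_exp_ofReal_mul_I _).le)
      unfold Function.uncurry
      exact Continuous.aestronglyMeasurable (by fun_prop)
  exact_mod_cast h2

omit [FiniteDimensional ℝ E] in
lemma continuous_charFun_of_isProbabilityMeasure : Continuous (charFun P) := by
  simp_rw [funext fun t => charFun_apply (μ := P) t]
  refine continuous_of_dominated (bound := fun _ => 1)
    (fun t => Continuous.aestronglyMeasurable (by fun_prop))
    (fun t => ae_of_all _ fun x => (Complex.norm_exp_ofReal_mul_I _).le)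
    (integrable_const _) (ae_of_all _ fun x => by fun_prop)

/-- High-frequency bound for the Gaussian average of a characteristic function, in terms of the
probability that two independent copies are close. -/
lemma lintegral_enorm_charFun_stdGaussian_le {r q : ℝ} (hr : 0 < r) (hq : 0 ≤ q)
    (hp : (P.prod P).real {p | ‖p.1 - p.2‖ ^ 2 < r} ≤ q) (t : ℝ) :
    ∫⁻ x, ‖charFun P ((t / √r) • x)‖ₑ ∂(stdGaussian E)
      ≤ ENNReal.ofReal (Real.exp (-t ^ 2 / 4) + √q) := by
  set τ := t / √r with hτ
  set f : E → ℝ := fun x => ‖charFun P (τ • x)‖ with hf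
  have hfc : Continuous f :=
    (continuous_charFun_of_isProbabilityMeasure.comp (by fun_prop)).norm
  have hfb : ∀ x, ‖f x‖ ≤ 1 := fun x => by
    rw [norm_norm]; exact norm_charFun_le_one _
  have hmem : MemLp f 2 (stdGaussian E) :=
    MemLp.of_bound hfc.aestronglyMeasurable 1 (ae_of_all _ hfb)
  have h1 := variance_nonneg f (stdGaussian E)
  rw [variance_eq_sub hmem] at h1
  simp only [Pi.pow_apply] at h1
  rw [integral_norm_charFun_smul_sq τ] at h1
  set A : Set (E × E) := {p | ‖p.1 - p.2‖ ^ 2 < r} with hA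
  have hAm : MeasurableSet A := measurableSet_lt (by fun_prop) (by fun_prop)
  have h2 : ∫ p, Real.exp (-(τ ^ 2 * ‖p.1 - p.2‖ ^ 2) / 2) ∂(P.prod P)
      ≤ Real.exp (-t ^ 2 / 2) + q := by
    calc _ ≤ ∫ p, (Real.exp (-t ^ 2 / 2) + A.indicator (fun _ => (1 : ℝ)) p) ∂(P.prod P) := by
          refine integral_mono_of_nonneg (ae_of_all _ fun p => Real.exp_nonneg _)
            ((integrable_const _).add ((integrable_const _).indicator hAm))
            (ae_of_all _ fun p => ?_)
          by_cases hpA : p ∈ A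
          · simp only [hpA, Set.indicator_of_mem]
            have : Real.exp (-(τ ^ 2 * ‖p.1 - p.2‖ ^ 2) / 2) ≤ 1 :=
              Real.exp_le_one_iff.2 (by
                have : 0 ≤ τ ^ 2 * ‖p.1 - p.2‖ ^ 2 := by positivity
                linarith)
            have := Real.exp_pos (-t ^ 2 / 2)
            linarith
          · simp only [hpA, not_false_eq_true, Set.indicator_of_notMem, add_zero]
            refine Real.exp_le_exp.2 ?_
            simp only [A, Set.mem_ofPred_eq, not_lt] at hpA
            have e : τ ^ 2 * r = t ^ 2 := by
              rw [hτ, div_pow, Real.sq_sqrt hr.le]; field_simp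
            have : τ ^ 2 * r ≤ τ ^ 2 * ‖p.1 - p.2‖ ^ 2 := by gcongr
            linarith
      _ ≤ _ := by
          rw [integral_add (integrable_const _) ((integrable_const _).indicator hAm),
            integral_indicator_const _ hAm]
          simpa using hp
  have h3 : ∫ x, f x ∂(stdGaussian E) ≤ Real.exp (-t ^ 2 / 4) + √q := by
    refine le_of_sq_le_sq ?_ (by positivity)
    have e1 : Real.exp (-t ^ 2 / 4) ^ 2 = Real.exp (-t ^ 2 / 2) := by
      rw [← Real.exp_nat_mul]; congr 1; push_cast; ring
    have e2 := Real.sq_sqrt hq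
    have : 0 ≤ Real.exp (-t ^ 2 / 4) * √q := by positivity
    nlinarith
  have h4 : ∫⁻ x, ‖charFun P (τ • x)‖ₑ ∂(stdGaussian E)
      = ENNReal.ofReal (∫ x, f x ∂(stdGaussian E)) := by
    rw [ofReal_integral_eq_lintegral_ofReal (hmem.integrable (by norm_num))
      (ae_of_all _ fun x => norm_nonneg _)]
    refine lintegral_congr fun x => ?_
    rw [ofReal_norm]
  rw [h4]
  exact ENNReal.ofReal_le_ofReal h3

end Symmetrization

section OneDim

lemma lintegral_comp_abs (f : ℝ → ℝ≥0∞) :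
    ∫⁻ t, f |t| = 2 * ∫⁻ t in Set.Ioi 0, f t := by
  have h1 : ∫⁻ t in Set.Ioi (0 : ℝ), f |t| = ∫⁻ t in Set.Ioi 0, f t :=
    setLIntegral_congr_fun measurableSet_Ioi fun t ht => by rw [abs_of_pos ht]
  have h2 : ∫⁻ t in Set.Iio (0 : ℝ), f |t| = ∫⁻ t in Set.Ioi 0, f t := by
    rw [← h1]
    have h := (Measure.measurePreserving_neg (volume : Measure ℝ)).setLIntegral_comp_preimage_emb
      (MeasurableEquiv.neg ℝ).measurableEmbedding (fun t => f |t|) (Set.Ioi 0)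
    simp only [abs_neg] at h
    rw [← h]
    simp
  rw [← lintegral_add_compl (fun t => f |t|) (measurableSet_Ioi (a := (0 : ℝ))), h1, Set.compl_Ioi,
    setLIntegral_congr Iio_ae_eq_Iic.symm, h2, two_mul]

lemma setLIntegral_le_abs (f : ℝ → ℝ≥0∞) {b : ℝ} (hb : 0 < b) :
    ∫⁻ t in {t : ℝ | b ≤ |t|}, f |t| = 2 * ∫⁻ t in Set.Ioi b, f t := by
  have hm : MeasurableSet {t : ℝ | b ≤ |t|} := measurableSet_le (by fun_prop) (by fun_prop)
  have h := lintegral_comp_abs ((Set.Ici b).indicator f)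
  rw [← lintegral_indicator hm]
  have e : ∀ t : ℝ, {t : ℝ | b ≤ |t|}.indicator (fun t => f |t|) t = (Set.Ici b).indicator f |t| := by
    intro t
    by_cases ht : b ≤ |t| <;> simp [Set.indicator, ht]
  simp_rw [e]
  rw [h, setLIntegral_indicator measurableSet_Ici,
    Set.inter_eq_left.2 (Set.Ici_subset_Ioi.2 hb), setLIntegral_congr Ioi_ae_eq_Ici.symm]

lemma lintegral_Ioi_mul_exp_neg_mul_sq {c : ℝ} (hc : 0 < c) {b : ℝ} (hb : 0 ≤ b) :
    ∫⁻ t in Set.Ioi b, ENNReal.ofReal (t * Real.exp (-c * t ^ 2))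
      = ENNReal.ofReal (Real.exp (-c * b ^ 2) / (2 * c)) := by
  have hd : ∀ t ∈ Set.Ici b, HasDerivAt (fun t => -Real.exp (-c * t ^ 2) / (2 * c))
      (t * Real.exp (-c * t ^ 2)) t := by
    intro t _
    have := ((((hasDerivAt_pow 2 t).const_mul (-c)).exp).neg).div_const (2 * c)
    refine this.congr_deriv ?_
    field_simp
    push_cast; ring
  have hpos : ∀ t ∈ Set.Ioi b, 0 ≤ t * Real.exp (-c * t ^ 2) := fun t ht =>
    mul_nonneg (hb.trans (le_of_lt ht)) (Real.exp_nonneg _)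
  have hlim : Filter.Tendsto (fun t : ℝ => -Real.exp (-c * t ^ 2) / (2 * c)) Filter.atTop
      (nhds 0) := by
    have h1 : Filter.Tendsto (fun t : ℝ => -c * t ^ 2) Filter.atTop Filter.atBot :=
      (Filter.tendsto_pow_atTop (by norm_num)).const_mul_atTop_of_neg (by linarith)
    have := ((Real.tendsto_exp_atBot.comp h1).neg).div_const (2 * c)
    simpa using this
  have hi := integrableOn_Ioi_deriv_of_nonneg' hd hpos hlim
  rw [← ofReal_integral_eq_lintegral_ofReal hi
    ((ae_restrict_iff' measurableSet_Ioi).2 (ae_of_all _ hpos)),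
    integral_Ioi_of_hasDerivAt_of_nonneg' hd hpos hlim]
  congr 1; ring

/-- A Gaussian tail integral against `dt / |t|`. -/
lemma setLIntegral_exp_div_abs_le {b : ℝ} (hb : 1 ≤ b) :
    ∫⁻ t in {t : ℝ | b ≤ |t|}, ENNReal.ofReal (Real.exp (-t ^ 2 / 4) / |t|)
      ≤ ENNReal.ofReal (4 * Real.exp (-b ^ 2 / 4)) := by
  have h0 := setLIntegral_le_abs (fun s => ENNReal.ofReal (Real.exp (-s ^ 2 / 4) / s))
    (show 0 < b by linarith)
  simp only [sq_abs] at h0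
  rw [h0]
  have h : ∫⁻ t in Set.Ioi b, ENNReal.ofReal (Real.exp (-t ^ 2 / 4) / t)
      ≤ ∫⁻ t in Set.Ioi b, ENNReal.ofReal (t * Real.exp (-(1 / 4) * t ^ 2)) := by
    refine setLIntegral_mono' measurableSet_Ioi fun t ht => ENNReal.ofReal_le_ofReal ?_
    have ht1 : 1 ≤ t := hb.trans (le_of_lt ht)
    rw [div_le_iff₀ (by linarith), show -t ^ 2 / 4 = -(1 / 4) * t ^ 2 by ring]
    have := Real.exp_pos (-(1 / 4) * t ^ 2)
    nlinarith [mul_le_mul ht1 ht1 (by norm_num) (by linarith)]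
  rw [lintegral_Ioi_mul_exp_neg_mul_sq (by norm_num) (by linarith)] at h
  calc _ ≤ 2 * _ := mul_le_mul_right h 2
    _ = _ := by
      rw [← ENNReal.ofReal_ofNat, ← ENNReal.ofReal_mul (by norm_num)]
      congr 1
      rw [show -b ^ 2 / 4 = -(1 / 4) * b ^ 2 by ring]; ring

/-- The logarithmic size of `∫ e^{-t²/(8r)} dt / |t|` away from the origin. -/
lemma setLIntegral_exp_div_abs_le_log {r b : ℝ} (hr : 1 ≤ r) (hb : 1 ≤ b) :
    ∫⁻ t in {t : ℝ | b ≤ |t|}, ENNReal.ofReal (Real.exp (-t ^ 2 / (8 * r)) / |t|)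
      ≤ ENNReal.ofReal (Real.log r + 8) := by
  have hr0 : 0 < r := by linarith
  have hsr : 1 ≤ √r := Real.one_le_sqrt.2 hr
  have hlog : 0 ≤ Real.log r := Real.log_nonneg hr
  have h0 := setLIntegral_le_abs (fun s => ENNReal.ofReal (Real.exp (-s ^ 2 / (8 * r)) / s))
    (show 0 < b by linarith)
  simp only [sq_abs] at h0
  rw [h0]
  -- The logarithm comes from the range `1 < t ≤ √r`; beyond it `1 / t ≤ t / r` and the Gaussian factor
  -- is integrated explicitly.
  have h1 : ∫⁻ t in Set.Ioc 1 √r, ENNReal.ofReal (1 / t) = ENNReal.ofReal (Real.log r / 2) := by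
    have hi : IntegrableOn (fun t : ℝ => 1 / t) (Set.Ioc 1 √r) := by
      rw [← intervalIntegrable_iff_integrableOn_Ioc_of_le hsr]
      refine intervalIntegral.intervalIntegrable_one_div (fun x hx => ?_) continuousOn_id
      rw [Set.uIcc_of_le hsr] at hx
      linarith [hx.1]
    rw [← ofReal_integral_eq_lintegral_ofReal hi, ← intervalIntegral.integral_of_le hsr,
      integral_one_div_of_pos (by norm_num) (by linarith), div_one, Real.log_sqrt hr0.le]
    refine (ae_restrict_iff' measurableSet_Ioc).2 (ae_of_all _ fun t ht => ?_)
    have : 0 < t := by linarith [ht.1]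
    simp only [Pi.zero_apply]; positivity
  have h2 : ∫⁻ t in Set.Ioi √r, ENNReal.ofReal (1 / r * (t * Real.exp (-(1 / (8 * r)) * t ^ 2)))
      ≤ ENNReal.ofReal 4 := by
    have e3 : ∀ t : ℝ, ENNReal.ofReal (1 / r * (t * Real.exp (-(1 / (8 * r)) * t ^ 2)))
        = ENNReal.ofReal (1 / r) * ENNReal.ofReal (t * Real.exp (-(1 / (8 * r)) * t ^ 2)) :=
      fun t => ENNReal.ofReal_mul (by positivity)
    rw [lintegral_congr e3]
    rw [lintegral_const_mul _ (by fun_prop), lintegral_Ioi_mul_exp_neg_mul_sq (by positivity)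
      (by positivity), ← ENNReal.ofReal_mul (by positivity)]
    refine ENNReal.ofReal_le_ofReal ?_
    have : Real.exp (-(1 / (8 * r)) * √r ^ 2) ≤ 1 := Real.exp_le_one_iff.2 (by
      rw [neg_mul]; exact neg_nonpos.2 (by positivity))
    have e4 : 1 / r * (Real.exp (-(1 / (8 * r)) * √r ^ 2) / (2 * (1 / (8 * r))))
        = 4 * Real.exp (-(1 / (8 * r)) * √r ^ 2) := by field_simp; norm_num
    rw [e4]; linarith
  have h3 : ∫⁻ t in Set.Ioi b, ENNReal.ofReal (Real.exp (-t ^ 2 / (8 * r)) / t)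
      ≤ ENNReal.ofReal (Real.log r / 2) + ENNReal.ofReal 4 := by
    calc _ ≤ ∫⁻ t in Set.Ioi 1, ENNReal.ofReal (Real.exp (-t ^ 2 / (8 * r)) / t) :=
          lintegral_mono_set (Set.Ioi_subset_Ioi hb)
      _ = (∫⁻ t in Set.Ioc 1 √r, ENNReal.ofReal (Real.exp (-t ^ 2 / (8 * r)) / t))
          + ∫⁻ t in Set.Ioi √r, ENNReal.ofReal (Real.exp (-t ^ 2 / (8 * r)) / t) := by
          rw [← Set.Ioc_union_Ioi_eq_Ioi hsr, lintegral_union measurableSet_Ioi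
            (Set.Ioc_disjoint_Ioi le_rfl)]
      _ ≤ _ := by
          rw [← h1]
          refine add_le_add (setLIntegral_mono' measurableSet_Ioc fun t ht =>
            ENNReal.ofReal_le_ofReal ?_) (le_trans (setLIntegral_mono' measurableSet_Ioi
              fun t ht => ENNReal.ofReal_le_ofReal ?_) h2)
          · have ht0 : 0 < t := by linarith [ht.1]
            gcongr
            refine Real.exp_le_one_iff.2 ?_
            rw [neg_div]; exact neg_nonpos.2 (by positivity)
          · have ht1 : √r < t := ht
            have ht0 : 0 < t := by linarith
            have hrt : r ≤ t ^ 2 := by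
              rw [← Real.sq_sqrt hr0.le]; gcongr
            have e4 : -t ^ 2 / (8 * r) = -(1 / (8 * r)) * t ^ 2 := by ring
            rw [e4, div_le_iff₀ ht0]
            have h5 : 1 ≤ 1 / r * t ^ 2 := by
              rw [one_div, inv_mul_eq_div, le_div_iff₀ hr0]; linarith
            have := Real.exp_pos (-(1 / (8 * r)) * t ^ 2)
            calc _ ≤ (1 / r * t ^ 2) * Real.exp (-(1 / (8 * r)) * t ^ 2) := by nlinarith
              _ = _ := by ring
  calc _ ≤ 2 * _ := mul_le_mul_right h3 2
    _ = _ := by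
      rw [← ENNReal.ofReal_add (by positivity) (by norm_num), ← ENNReal.ofReal_ofNat,
        ← ENNReal.ofReal_mul (by norm_num)]
      congr 1; ring

end OneDim

/-! ### Moments of the martingale differences -/

section MartingaleMoments

variable {Ω : Type*} {mΩ : MeasurableSpace Ω} {μ : Measure Ω} [IsProbabilityMeasure μ] {n : ℕ}
  {ℱ : Filtration (Fin (n + 1)) mΩ} {d : Fin n → Ω → ℝ}

omit [IsProbabilityMeasure μ] in
lemma IsMartingaleDifference.measurable' (hd : IsMartingaleDifference d ℱ μ) (i : Fin n) :
    Measurable (d i) :=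
  (hd.measurable i).mono (ℱ.le _) le_rfl

omit [IsProbabilityMeasure μ] in
lemma memLp_sq_of_memLp_four {f : Ω → ℝ} (hf : MemLp f 4 μ) : MemLp (fun ω => f ω ^ 2) 2 μ := by
  have h := hf.norm_rpow_div (q := 2)
  have e : (4 : ℝ≥0∞) / 2 = 2 := by
    rw [← ENNReal.toReal_eq_toReal_iff' (by finiteness) (by finiteness)]
    norm_num
  rw [e] at h
  simpa using h

omit [IsProbabilityMeasure μ] in
lemma integrable_pow_four {f : Ω → ℝ} (hf : MemLp f 4 μ) : Integrable (fun ω => f ω ^ 4) μ := by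
  refine (memLp_sq_of_memLp_four hf).integrable_sq.congr (ae_of_all _ fun ω => ?_)
  simp only; ring

lemma integrable_abs_pow_three {f : Ω → ℝ} (hf : MemLp f 4 μ) :
    Integrable (fun ω => |f ω| ^ 3) μ := by
  refine ((integrable_const (1 : ℝ)).add (integrable_pow_four hf)).mono'
    ((hf.1.norm.pow 3)) (ae_of_all _ fun ω => ?_)
  rw [Real.norm_of_nonneg (by positivity)]
  simp only [Pi.add_apply]
  have e : f ω ^ 4 = |f ω| ^ 4 := by rw [← abs_pow, abs_of_nonneg (by positivity)]
  rw [e]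
  rcases le_or_gt |f ω| 1 with h | h
  · have : |f ω| ^ 3 ≤ 1 := pow_le_one₀ (abs_nonneg _) h
    have : 0 ≤ |f ω| ^ 4 := by positivity
    linarith
  · have : |f ω| ^ 3 ≤ |f ω| ^ 4 := pow_le_pow_right₀ h.le (by norm_num)
    linarith

lemma sq_integral_sq_le {f : Ω → ℝ} (hf : MemLp f 4 μ) :
    (∫ ω, f ω ^ 2 ∂μ) ^ 2 ≤ ∫ ω, f ω ^ 4 ∂μ := by
  have h := variance_nonneg (fun ω => f ω ^ 2) μ
  rw [variance_eq_sub (memLp_sq_of_memLp_four hf)] at h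
  have e : ∫ ω, ((fun ω => f ω ^ 2) ^ 2) ω ∂μ = ∫ ω, f ω ^ 4 ∂μ :=
    integral_congr_ae (ae_of_all _ fun ω => by simp only [Pi.pow_apply]; ring)
  rw [e] at h
  linarith

lemma IsMartingaleDifference.integral_mul_eq_zero (hd : IsMartingaleDifference d ℱ μ)
    (hL4 : ∀ k, MemLp (d k) 4 μ) {j k : Fin n} (hjk : j ≠ k) :
    ∫ ω, d j ω * d k ω ∂μ = 0 := by
  wlog h : j < k generalizing j k
  · have := this hjk.symm (lt_of_le_of_ne (not_lt.1 h) hjk.symm)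
    rw [← this]
    exact integral_congr_ae (ae_of_all _ fun ω => mul_comm _ _)
  have hL2 : ∀ k, MemLp (d k) 2 μ := fun k => (hL4 k).mono_exponent (by norm_num)
  have hm : Measurable[ℱ k.castSucc] (d j) :=
    (hd.measurable j).mono (ℱ.mono (by simpa [Fin.le_def] using h)) le_rfl
  have h1 := condExp_mul_of_stronglyMeasurable_left (μ := μ) hm.stronglyMeasurable
    ((hL2 j).integrable_mul (hL2 k)) (hd.integrable k)
  calc ∫ ω, d j ω * d k ω ∂μ = ∫ ω, (μ[d j * d k | ℱ k.castSucc]) ω ∂μ :=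
        (integral_condExp (ℱ.le _)).symm
    _ = 0 := by
        refine integral_eq_zero_of_ae ?_
        filter_upwards [h1, hd.condExp_eq_zero k] with ω h2 h3
        rw [h2, Pi.mul_apply, h3]
        simp

variable {α : ℝ}

/-- Some difference has second moment at least one, as these average to one. -/
lemma one_le_of_fourth_moment_le (hn : 0 < n) (hL4 : ∀ k, MemLp (d k) 4 μ)
    (hα : ∀ k, ∫ ω, d k ω ^ 4 ∂μ ≤ α) (hsum : ∑ k, ∫ ω, d k ω ^ 2 ∂μ = (n : ℝ)) : 1 ≤ α := by
  obtain ⟨k, -, hk⟩ : ∃ k ∈ Finset.univ, (1 : ℝ) ≤ ∫ ω, d k ω ^ 2 ∂μ := by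
    refine Finset.exists_le_of_sum_le ⟨⟨0, hn⟩, Finset.mem_univ _⟩ ?_
    rw [hsum]; simp
  have := sq_integral_sq_le (hL4 k)
  have := hα k
  nlinarith

omit [IsProbabilityMeasure μ] in
lemma memLp_sum_sq (hL4 : ∀ k, MemLp (d k) 4 μ) : MemLp (fun ω => ∑ k, d k ω ^ 2) 2 μ :=
  memLp_finsetSum _ fun k _ => memLp_sq_of_memLp_four (hL4 k)

lemma integral_sum_sq_sub_sq (hn : 0 < n) (hL4 : ∀ k, MemLp (d k) 4 μ)
    (hsum : ∑ k, ∫ ω, d k ω ^ 2 ∂μ = (n : ℝ)) :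
    ∫ ω, (∑ k, d k ω ^ 2 - n) ^ 2 ∂μ = n * sigmaFourSq d μ := by
  have hm : ∫ ω, ∑ k, d k ω ^ 2 ∂μ = n := by
    rw [integral_finsetSum _ fun k _ => (memLp_sq_of_memLp_four (hL4 k)).integrable (by norm_num),
      hsum]
  have hn' : (n : ℝ) ≠ 0 := by positivity
  rw [sigmaFourSq, variance_eq_integral (memLp_sum_sq hL4).1.aemeasurable, hm]
  field_simp

lemma sum_integral_sq_sub_one_sq_le (hL4 : ∀ k, MemLp (d k) 4 μ)
    (hα : ∀ k, ∫ ω, d k ω ^ 4 ∂μ ≤ α) (hsum : ∑ k, ∫ ω, d k ω ^ 2 ∂μ = (n : ℝ)) :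
    ∑ k, ∫ ω, (d k ω ^ 2 - 1) ^ 2 ∂μ ≤ n * α := by
  have e : ∀ k, ∫ ω, (d k ω ^ 2 - 1) ^ 2 ∂μ
      = ∫ ω, d k ω ^ 4 ∂μ - 2 * ∫ ω, d k ω ^ 2 ∂μ + 1 := by
    intro k
    have h2 : Integrable (fun ω => d k ω ^ 2) μ :=
      (memLp_sq_of_memLp_four (hL4 k)).integrable (by norm_num)
    have h4 := integrable_pow_four (hL4 k)
    have : ∀ ω, (d k ω ^ 2 - 1) ^ 2 = d k ω ^ 4 - 2 * d k ω ^ 2 + 1 := fun ω => by ring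
    have h5 : Integrable (fun ω => d k ω ^ 4 - 2 * d k ω ^ 2) μ := h4.sub (h2.const_mul 2)
    simp_rw [this]
    rw [integral_add h5 (integrable_const _), integral_sub h4 (h2.const_mul 2), integral_const_mul]
    simp
  simp_rw [e]
  rw [Finset.sum_add_distrib, Finset.sum_sub_distrib, ← Finset.mul_sum, hsum]
  have : ∑ k, ∫ ω, d k ω ^ 4 ∂μ ≤ ∑ _k : Fin n, α := Finset.sum_le_sum fun k _ => hα k
  simp only [Finset.sum_const, Finset.card_univ, Fintype.card_fin, nsmul_eq_mul] at this
  simp only [Finset.sum_const, Finset.card_univ, Fintype.card_fin, nsmul_eq_mul, mul_one]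
  have : (0 : ℝ) ≤ n := by positivity
  linarith

omit [IsProbabilityMeasure μ] in
lemma sigmaFourSq_nonneg : 0 ≤ sigmaFourSq d μ :=
  mul_nonneg (by positivity) (variance_nonneg _ _)

lemma sqrt_sigmaFourSq_le_cTwo (hL4 : ∀ k, MemLp (d k) 4 μ) :
    √(sigmaFourSq d μ) ≤ cTwo d μ := by
  refine Real.sqrt_le_sqrt ?_
  rw [sigmaFourSq]
  refine mul_le_mul_of_nonneg_left ?_ (by positivity)
  have h := variance_fun_sum (μ := μ) (X := fun k ω => d k ω ^ 2)
    (fun k => memLp_sq_of_memLp_four (hL4 k))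
  rw [h]
  exact Finset.sum_le_sum fun k _ => Finset.sum_le_sum fun l _ => le_abs_self _

end MartingaleMoments

/-! ### Low frequencies -/

section LowFrequency

variable {Ω : Type*} {mΩ : MeasurableSpace Ω} {μ : Measure Ω} [IsProbabilityMeasure μ] {n : ℕ}
  {ℱ : Filtration (Fin (n + 1)) mΩ} {d : Fin n → Ω → ℝ}

/-- The filtration indexed by `Fin (n + 1)`, continued to `ℕ` by its last term. -/
def extendFiltration (ℱ : Filtration (Fin (n + 1)) mΩ) : Filtration ℕ mΩ where
  seq k := ℱ ⟨min k n, by omega⟩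
  mono' i j hij := ℱ.mono (by simp only [Fin.mk_le_mk]; omega)
  le' k := ℱ.le _

/-- McLeish's comparison for the sum with fixed weights `a`. -/
lemma IsMartingaleDifference.norm_charFun_sub_le (hd : IsMartingaleDifference d ℱ μ)
    (hL4 : ∀ k, MemLp (d k) 4 μ) (a : Fin n → ℝ) {v : ℝ} (hv : 0 ≤ v) :
    ‖∫ ω, Complex.exp ((∑ k, a k * d k ω : ℝ) * Complex.I) ∂μ - Real.exp (-v / 2)‖
      ≤ ∫ ω, (5 * |∑ k, (a k * d k ω) ^ 2 - v| + 4 * ∑ k, |a k * d k ω| ^ 3) ∂μ := by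
  let x : ℕ → Ω → ℝ := fun k ω => if h : k < n then a ⟨k, h⟩ * d ⟨k, h⟩ ω else 0
  have hlt : ∀ {k} (h : k < n), x k = fun ω => a ⟨k, h⟩ * d ⟨k, h⟩ ω := by
    intro k h; ext ω; simp [x, h]
  have hge : ∀ {k} (h : ¬ k < n), x k = fun _ => 0 := by
    intro k h; ext ω; simp [x, h]
  have hsucc : ∀ {k} (h : k < n), extendFiltration ℱ (k + 1) = ℱ (Fin.succ ⟨k, h⟩) := by
    intro k h
    change ℱ _ = ℱ _
    congr 1
    simp only [Fin.succ_mk, Fin.mk.injEq]; omega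
  have hcast : ∀ {k} (h : k < n), extendFiltration ℱ k = ℱ (Fin.castSucc ⟨k, h⟩) := by
    intro k h
    change ℱ _ = ℱ _
    congr 1
    simp only [Fin.castSucc_mk, Fin.mk.injEq]; omega
  have hmem : ∀ k, MemLp (x k) 4 μ := by
    intro k
    by_cases h : k < n
    · rw [hlt h]; exact (hL4 _).const_mul _
    · rw [hge h]; exact MemLp.zero'
  have key := norm_integral_exp_sub_le (μ := μ) (ℱ := extendFiltration ℱ) (x := x)
    (fun k => by
      by_cases h : k < n
      · rw [hlt h, hsucc h]; exact (hd.measurable _).const_mul _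
      · rw [hge h]; exact measurable_const)
    (fun k => (hmem k).integrable (by norm_num))
    (fun k => (memLp_sq_of_memLp_four (hmem k)).integrable (by norm_num))
    (fun k => integrable_abs_pow_three (hmem k))
    (fun k => by
      by_cases h : k < n
      · rw [hlt h, hcast h]
        have h1 := condExp_smul (μ := μ) (a ⟨k, h⟩) (d ⟨k, h⟩) (ℱ (Fin.castSucc ⟨k, h⟩))
        filter_upwards [h1, hd.condExp_eq_zero ⟨k, h⟩] with ω h2 h3
        refine Eq.trans h2 ?_
        rw [Pi.smul_apply, h3]; simp
      · rw [hge h]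
        exact (condExp_zero (E := ℝ)).eventuallyEq) hv n
  have hx : ∀ k : Fin n, x k = fun ω => a k * d k ω := fun k => hlt k.2
  simp only [Finset.sum_range, hx] at key
  exact key

/-- The vector `(d₁, …, dₙ)` in Euclidean space. -/
noncomputable def diffVector (d : Fin n → Ω → ℝ) (ω : Ω) : EuclideanSpace ℝ (Fin n) :=
  WithLp.toLp 2 fun k => d k ω

lemma measurable_diffVector (hd : ∀ k, Measurable (d k)) : Measurable (diffVector d) :=
  (MeasurableEquiv.toLp 2 (Fin n → ℝ)).measurable.comp (measurable_pi_lambda _ hd)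

lemma inner_diffVector (u : EuclideanSpace ℝ (Fin n)) (ω : Ω) :
    ⟪diffVector d ω, u⟫ = ∑ k, u k * d k ω := by
  simp [PiLp.inner_apply, diffVector]

omit [IsProbabilityMeasure μ] in
lemma charFun_map_diffVector (hd : ∀ k, Measurable (d k)) (u : EuclideanSpace ℝ (Fin n)) :
    charFun (μ.map (diffVector d)) u
      = ∫ ω, Complex.exp ((∑ k, u k * d k ω : ℝ) * Complex.I) ∂μ := by
  rw [charFun_apply, integral_map (measurable_diffVector hd).aemeasurable
    (Continuous.aestronglyMeasurable (by fun_prop))]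
  simp_rw [inner_diffVector]

variable {α : ℝ}

/-- For a unit vector `u`, the error terms of McLeish's comparison in a form that is quadratic
and quartic in `u`, whence can be averaged over the sphere. The weight `a` is free. -/
lemma IsMartingaleDifference.norm_charFun_smul_sub_le (hn : 0 < n)
    (hd : IsMartingaleDifference d ℱ μ) (hL4 : ∀ k, MemLp (d k) 4 μ)
    (hα : ∀ k, ∫ ω, d k ω ^ 4 ∂μ ≤ α) (hα1 : 1 ≤ α) {u : EuclideanSpace ℝ (Fin n)}
    (hu : ‖u‖ = 1) (t : ℝ) {a : ℝ} (ha : 0 < a) :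
    ‖charFun (μ.map (diffVector d)) (t • u) - Real.exp (-t ^ 2 / 2)‖
      ≤ 5 * t ^ 2 * ((a + a⁻¹ * ∫ ω, (∑ k, (d k ω ^ 2 - 1) * u k ^ 2) ^ 2 ∂μ) / 2)
        + 4 * |t| ^ 3 * ((√n * α * ∑ k, u k ^ 4 + α / √n) / 2) := by
  have hn' : (0 : ℝ) < n := by exact_mod_cast hn
  have hsq : 0 < √(n : ℝ) := Real.sqrt_pos.2 hn'
  have hu2 : ∑ k, u k ^ 2 = 1 := by
    rw [← EuclideanSpace.real_norm_sq_eq, hu]; norm_num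
  have h2 : ∀ k, MemLp (fun ω => d k ω ^ 2) 2 μ := fun k => memLp_sq_of_memLp_four (hL4 k)
  have h2i : ∀ k, Integrable (fun ω => d k ω ^ 2) μ := fun k => (h2 k).integrable (by norm_num)
  have h4i : ∀ k, Integrable (fun ω => d k ω ^ 4) μ := fun k => integrable_pow_four (hL4 k)
  have hW : MemLp (fun ω => ∑ k, (d k ω ^ 2 - 1) * u k ^ 2) 2 μ :=
    memLp_finsetSum _ fun k _ => ((h2 k).sub (memLp_const 1)).mul_const _
  have hWi := hW.integrable_sq
  rw [charFun_map_diffVector hd.measurable']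
  have key := hd.norm_charFun_sub_le hL4 (fun k => t * u k) (sq_nonneg t)
  refine key.trans ?_
  -- Two instances of the arithmetic-geometric mean inequality: `|z| ≤ (a + z² / a) / 2`, and
  -- `y³ ≤ (√n y⁴ + y² / √n) / 2`, balanced for `y` of order `1 / √n`.
  have hpt : ∀ ω, 5 * |∑ k, (t * u k * d k ω) ^ 2 - t ^ 2| + 4 * ∑ k, |t * u k * d k ω| ^ 3
      ≤ 5 * t ^ 2 * ((a + a⁻¹ * (∑ k, (d k ω ^ 2 - 1) * u k ^ 2) ^ 2) / 2)
        + 4 * |t| ^ 3 * ((√n * ∑ k, u k ^ 4 * d k ω ^ 4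
            + (∑ k, u k ^ 2 * d k ω ^ 2) / √n) / 2) := by
    intro ω
    refine add_le_add ?_ ?_
    · have e : ∑ k, (t * u k * d k ω) ^ 2 - t ^ 2
          = t ^ 2 * ∑ k, (d k ω ^ 2 - 1) * u k ^ 2 := by
        have : ∀ k, (d k ω ^ 2 - 1) * u k ^ 2 = (u k * d k ω) ^ 2 - u k ^ 2 := fun k => by ring
        simp_rw [this]
        rw [Finset.sum_sub_distrib, hu2, mul_sub, Finset.mul_sum]
        congr 1
        · exact Finset.sum_congr rfl fun k _ => by ring
        · ring
      rw [e, abs_mul, abs_of_nonneg (sq_nonneg t), ← mul_assoc]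
      refine mul_le_mul_of_nonneg_left ?_ (by positivity)
      set z := ∑ k, (d k ω ^ 2 - 1) * u k ^ 2
      have h := two_mul_le_add_sq a |z|
      rw [sq_abs] at h
      have e2 : (a + a⁻¹ * z ^ 2) / 2 = (a ^ 2 + z ^ 2) / (2 * a) := by field_simp
      rw [e2, le_div_iff₀ (by positivity)]
      linarith
    · rw [mul_assoc 4]
      refine mul_le_mul_of_nonneg_left ?_ (by norm_num)
      have e : (√n * ∑ k, u k ^ 4 * d k ω ^ 4 + (∑ k, u k ^ 2 * d k ω ^ 2) / √n) / 2
          = ∑ k, (√n * (u k ^ 4 * d k ω ^ 4) + (u k ^ 2 * d k ω ^ 2) / √n) / 2 := by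
        rw [← Finset.sum_div, Finset.sum_add_distrib, Finset.mul_sum, Finset.sum_div]
      rw [e, Finset.mul_sum]
      refine Finset.sum_le_sum fun k _ => ?_
      rw [mul_assoc t, abs_mul, mul_pow]
      refine mul_le_mul_of_nonneg_left ?_ (by positivity)
      set y := |u k * d k ω| with hy
      have hy0 : 0 ≤ y := abs_nonneg _
      have ey : u k ^ 4 * d k ω ^ 4 = y ^ 4 := by
        rw [hy, ← abs_pow, abs_of_nonneg (by positivity)]; ring
      have ey2 : u k ^ 2 * d k ω ^ 2 = y ^ 2 := by
        rw [hy, sq_abs]; ring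
      rw [ey, ey2]
      have e2 : (√n * y ^ 4 + y ^ 2 / √n) / 2 = y ^ 2 * ((√n * y) ^ 2 + 1) / (2 * √n) := by
        field_simp
      rw [e2, le_div_iff₀ (by positivity)]
      nlinarith [mul_nonneg (sq_nonneg y) (sq_nonneg (√n * y - 1))]
  have hi1 : Integrable (fun ω => 5 * t ^ 2 *
      ((a + a⁻¹ * (∑ k, (d k ω ^ 2 - 1) * u k ^ 2) ^ 2) / 2)) μ :=
    ((((integrable_const a).add (hWi.const_mul a⁻¹)).div_const 2).const_mul _)
  have hi4 : Integrable (fun ω => ∑ k, u k ^ 4 * d k ω ^ 4) μ :=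
    integrable_finsetSum _ fun k _ => (h4i k).const_mul _
  have hi3 : Integrable (fun ω => ∑ k, u k ^ 2 * d k ω ^ 2) μ :=
    integrable_finsetSum _ fun k _ => (h2i k).const_mul _
  have hi2 : Integrable (fun ω => 4 * |t| ^ 3 * ((√n * ∑ k, u k ^ 4 * d k ω ^ 4
            + (∑ k, u k ^ 2 * d k ω ^ 2) / √n) / 2)) μ :=
    ((((hi4.const_mul _).add (hi3.div_const _)).div_const 2).const_mul _)
  calc _ ≤ ∫ ω, (5 * t ^ 2 * ((a + a⁻¹ * (∑ k, (d k ω ^ 2 - 1) * u k ^ 2) ^ 2) / 2)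
        + 4 * |t| ^ 3 * ((√n * ∑ k, u k ^ 4 * d k ω ^ 4
            + (∑ k, u k ^ 2 * d k ω ^ 2) / √n) / 2)) ∂μ :=
        integral_mono_of_nonneg (ae_of_all _ fun ω => by positivity) (hi1.add hi2)
          (ae_of_all _ hpt)
    _ = 5 * t ^ 2 * ((a + a⁻¹ * ∫ ω, (∑ k, (d k ω ^ 2 - 1) * u k ^ 2) ^ 2 ∂μ) / 2)
        + 4 * |t| ^ 3 * ((√n * ∑ k, u k ^ 4 * ∫ ω, d k ω ^ 4 ∂μ
            + (∑ k, u k ^ 2 * ∫ ω, d k ω ^ 2 ∂μ) / √n) / 2) := by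
        rw [integral_add hi1 hi2, integral_const_mul, integral_const_mul, integral_div,
          integral_div, integral_add (integrable_const _) (hWi.const_mul _), integral_const_mul,
          integral_add (hi4.const_mul _) (hi3.div_const _), integral_const_mul, integral_div,
          integral_finsetSum _ fun k _ => (h4i k).const_mul _,
          integral_finsetSum _ fun k _ => (h2i k).const_mul _]
        simp_rw [integral_const_mul]
        simp
    _ ≤ _ := by
        have b1 : ∑ k, u k ^ 4 * ∫ ω, d k ω ^ 4 ∂μ ≤ α * ∑ k, u k ^ 4 := by
          rw [mul_comm, Finset.sum_mul]
          exact Finset.sum_le_sum fun k _ => mul_le_mul_of_nonneg_left (hα k) (by positivity)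
        have b2 : ∑ k, u k ^ 2 * ∫ ω, d k ω ^ 2 ∂μ ≤ α := by
          calc _ ≤ ∑ k, u k ^ 2 * α := Finset.sum_le_sum fun k _ =>
                mul_le_mul_of_nonneg_left (by
                  have h := (sq_integral_sq_le (hL4 k)).trans (hα k)
                  nlinarith) (by positivity)
            _ = α := by rw [← Finset.sum_mul, hu2, one_mul]
        rw [mul_assoc (√(n : ℝ))]
        gcongr

/-- Averaged over the sphere, the characteristic function of `⟨u, X⟩` is close to the Gaussian one
at every frequency. -/
lemma IsMartingaleDifference.lintegral_norm_charFun_sub_le (hn : 0 < n)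
    (hd : IsMartingaleDifference d ℱ μ) (hL4 : ∀ k, MemLp (d k) 4 μ)
    (hα : ∀ k, ∫ ω, d k ω ^ 4 ∂μ ≤ α) (hsum : ∑ k, ∫ ω, d k ω ^ 2 ∂μ = (n : ℝ)) (t : ℝ) :
    ∫⁻ u, ENNReal.ofReal ‖charFun (μ.map (diffVector d)) (t • u) - Real.exp (-t ^ 2 / 2)‖
        ∂(uniformSphere n)
      ≤ ENNReal.ofReal (5 * t ^ 2 * √((sigmaFourSq d μ + 2 * α) / n)
        + 4 * |t| ^ 3 * (2 * α / √n)) := by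
  have hn' : (0 : ℝ) < n := by exact_mod_cast hn
  have hsq : 0 < √(n : ℝ) := Real.sqrt_pos.2 hn'
  have hα1 := one_le_of_fourth_moment_le hn hL4 hα hsum
  have := isProbabilityMeasure_uniformSphere hn
  have hs0 : 0 ≤ sigmaFourSq d μ := sigmaFourSq_nonneg
  set s := sigmaFourSq d μ with hs
  set A := √((s + 2 * α) / n) with hA
  have hA0 : 0 < A := Real.sqrt_pos.2 (by positivity)
  have hAsq : A ^ 2 = (s + 2 * α) / n := Real.sq_sqrt (by positivity)
  have hdm := hd.measurable'
  have h2 : ∀ k, MemLp (fun ω => d k ω ^ 2) 2 μ := fun k => memLp_sq_of_memLp_four (hL4 k)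
  have hW : ∀ u : EuclideanSpace ℝ (Fin n),
      Integrable (fun ω => (∑ k, (d k ω ^ 2 - 1) * u k ^ 2) ^ 2) μ := fun u =>
    (memLp_finsetSum _ fun k _ => ((h2 k).sub (memLp_const 1)).mul_const _).integrable_sq
  -- The weight `a` of the previous lemma is taken to be `A`, the bound for the root mean square of the
  -- quadratic form.
  have hQ : ∫⁻ u, ENNReal.ofReal (∫ ω, (∑ k, (d k ω ^ 2 - 1) * u k ^ 2) ^ 2 ∂μ)
      ∂(uniformSphere n) ≤ ENNReal.ofReal (A ^ 2) := by
    have e : ∀ u : EuclideanSpace ℝ (Fin n),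
        ENNReal.ofReal (∫ ω, (∑ k, (d k ω ^ 2 - 1) * u k ^ 2) ^ 2 ∂μ)
        = ∫⁻ ω, ENNReal.ofReal ((∑ k, (d k ω ^ 2 - 1) * u k ^ 2) ^ 2) ∂μ := fun u =>
      ofReal_integral_eq_lintegral_ofReal (hW u) (ae_of_all _ fun ω => sq_nonneg _)
    simp_rw [e]
    rw [lintegral_lintegral_swap (Measurable.aemeasurable (by fun_prop))]
    have hi1 : Integrable (fun ω => (∑ k, (d k ω ^ 2 - 1)) ^ 2) μ :=
      (memLp_finsetSum _ fun k _ => (h2 k).sub (memLp_const 1)).integrable_sq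
    have hi2 : ∀ k, Integrable (fun ω => (d k ω ^ 2 - 1) ^ 2) μ := fun k =>
      ((h2 k).sub (memLp_const 1)).integrable_sq
    have hi3 : Integrable (fun ω => ∑ k, (d k ω ^ 2 - 1) ^ 2) μ :=
      integrable_finsetSum _ fun k _ => hi2 k
    calc _ ≤ ∫⁻ ω, ENNReal.ofReal (((∑ k, (d k ω ^ 2 - 1)) ^ 2
          + 2 * ∑ k, (d k ω ^ 2 - 1) ^ 2) / n ^ 2) ∂μ :=
          lintegral_mono fun ω => lintegral_sum_sq_mul_sq_uniformSphere_le hn _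
      _ = ENNReal.ofReal (∫ ω, ((∑ k, (d k ω ^ 2 - 1)) ^ 2
          + 2 * ∑ k, (d k ω ^ 2 - 1) ^ 2) / n ^ 2 ∂μ) :=
          (ofReal_integral_eq_lintegral_ofReal ((hi1.add (hi3.const_mul 2)).div_const _)
            (ae_of_all _ fun ω => div_nonneg (add_nonneg (sq_nonneg _) (mul_nonneg zero_le_two
              (Finset.sum_nonneg fun _ _ => sq_nonneg _))) (sq_nonneg _))).symm
      _ ≤ _ := by
          refine ENNReal.ofReal_le_ofReal ?_
          rw [integral_div, integral_add hi1 (hi3.const_mul 2), integral_const_mul,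
            integral_finsetSum _ fun k _ => hi2 k]
          have e1 : ∫ ω, (∑ k, (d k ω ^ 2 - 1)) ^ 2 ∂μ = n * s := by
            rw [← integral_sum_sq_sub_sq hn hL4 hsum]
            simp [Finset.sum_sub_distrib]
          have e2 := sum_integral_sq_sub_one_sq_le hL4 hα hsum
          rw [e1, hAsq, div_le_div_iff₀ (by positivity) hn']
          nlinarith
  -- Each fourth moment of a coordinate is the second moment of the quadratic form `u k ^ 2`.
  have hU : ∫⁻ u, ENNReal.ofReal (∑ k, u k ^ 4) ∂(uniformSphere n) ≤ ENNReal.ofReal (3 / n) := by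
    have e : ∀ u : EuclideanSpace ℝ (Fin n), ENNReal.ofReal (∑ k, u k ^ 4)
        = ∑ k, ENNReal.ofReal ((∑ j, (if j = k then (1 : ℝ) else 0) * u j ^ 2) ^ 2) := by
      intro u
      rw [ENNReal.ofReal_sum_of_nonneg fun k _ => by positivity]
      refine Finset.sum_congr rfl fun k _ => ?_
      congr 1
      simp
      ring
    simp_rw [e]
    rw [lintegral_finsetSum _ fun k _ => by fun_prop]
    calc _ ≤ ∑ k : Fin n, ENNReal.ofReal (((∑ j, (if j = k then (1 : ℝ) else 0)) ^ 2
          + 2 * ∑ j, (if j = k then (1 : ℝ) else 0) ^ 2) / n ^ 2) :=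
          Finset.sum_le_sum fun k _ => lintegral_sum_sq_mul_sq_uniformSphere_le hn _
      _ = ∑ k : Fin n, ENNReal.ofReal (3 / n ^ 2) := by
          refine Finset.sum_congr rfl fun k _ => ?_
          congr 2
          simp
          norm_num
      _ = _ := by
          rw [← ENNReal.ofReal_sum_of_nonneg fun k _ => by positivity]
          congr 1
          simp only [Finset.sum_const, Finset.card_univ, Fintype.card_fin, nsmul_eq_mul]
          field_simp
  have hmI : Measurable fun u : EuclideanSpace ℝ (Fin n) =>
      ENNReal.ofReal (∫ ω, (∑ k, (d k ω ^ 2 - 1) * u k ^ 2) ^ 2 ∂μ) := by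
    refine Measurable.ennreal_ofReal (StronglyMeasurable.measurable ?_)
    refine StronglyMeasurable.integral_prod_right (f := fun (u : EuclideanSpace ℝ (Fin n)) ω =>
      (∑ k, (d k ω ^ 2 - 1) * u k ^ 2) ^ 2) (Measurable.stronglyMeasurable ?_)
    unfold Function.uncurry
    fun_prop
  calc _ ≤ ∫⁻ u, ((ENNReal.ofReal (5 * t ^ 2 * (A / 2) + 4 * |t| ^ 3 * (α / √n / 2))
        + ENNReal.ofReal (5 * t ^ 2 * (A⁻¹ / 2))
          * ENNReal.ofReal (∫ ω, (∑ k, (d k ω ^ 2 - 1) * u k ^ 2) ^ 2 ∂μ))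
        + ENNReal.ofReal (4 * |t| ^ 3 * (√n * α / 2)) * ENNReal.ofReal (∑ k, u k ^ 4))
        ∂(uniformSphere n) := by
        refine lintegral_mono_ae ?_
        filter_upwards [ae_norm_eq_one_uniformSphere] with u hu
        have hI : 0 ≤ ∫ ω, (∑ k, (d k ω ^ 2 - 1) * u k ^ 2) ^ 2 ∂μ :=
          integral_nonneg fun ω => sq_nonneg _
        have h4 : 0 ≤ ∑ k, u k ^ 4 := Finset.sum_nonneg fun k _ => by positivity
        rw [← ENNReal.ofReal_mul (by positivity), ← ENNReal.ofReal_mul (by positivity),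
          ← ENNReal.ofReal_add (by positivity) (by positivity),
          ← ENNReal.ofReal_add (by positivity) (by positivity)]
        refine ENNReal.ofReal_le_ofReal ?_
        refine (hd.norm_charFun_smul_sub_le hn hL4 hα hα1 hu t hA0).trans (le_of_eq ?_)
        ring
    _ ≤ (ENNReal.ofReal (5 * t ^ 2 * (A / 2) + 4 * |t| ^ 3 * (α / √n / 2))
        + ENNReal.ofReal (5 * t ^ 2 * (A⁻¹ / 2)) * ENNReal.ofReal (A ^ 2))
        + ENNReal.ofReal (4 * |t| ^ 3 * (√n * α / 2)) * ENNReal.ofReal (3 / n) := by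
        rw [lintegral_add_right _ (by fun_prop), lintegral_add_right _ (by fun_prop),
          lintegral_const, measure_univ, mul_one, lintegral_const_mul _ hmI,
          lintegral_const_mul _ (by fun_prop)]
        gcongr
    _ = _ := by
        rw [← ENNReal.ofReal_mul (by positivity), ← ENNReal.ofReal_mul (by positivity),
          ← ENNReal.ofReal_add (by positivity) (by positivity),
          ← ENNReal.ofReal_add (by positivity) (by positivity)]
        congr 1
        have e1 : A⁻¹ / 2 * A ^ 2 = A / 2 := by field_simp
        have e2 : √n * α / 2 * (3 / n) = 3 / 2 * (α / √n) := by
          have : (n : ℝ) = √n * √n := (Real.mul_self_sqrt hn'.le).symm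
          rw [this, Real.sqrt_mul_self hsq.le]
          field_simp
        calc _ = 5 * t ^ 2 * (A / 2 + A⁻¹ / 2 * A ^ 2)
              + 4 * |t| ^ 3 * (α / √n / 2 + √n * α / 2 * (3 / n)) := by ring
          _ = _ := by rw [e1, e2]; ring

end LowFrequency

/-! ### Independent copies are far apart -/

section Separation

variable {n : ℕ} {P : Measure (EuclideanSpace ℝ (Fin n))} [IsProbabilityMeasure P]

/-- Chebyshev's inequality for `‖x - y‖² - 2n`, where `x` and `y` are independent with law `P`. -/
lemma prod_real_norm_sub_sq_lt_le (hn : 0 < n) {s α : ℝ}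
    (hmem : ∀ j, MemLp (fun x : EuclideanSpace ℝ (Fin n) => x j) 4 P)
    (h1 : ∫ x, (‖x‖ ^ 2 - n) ^ 2 ∂P ≤ n * s)
    (h2 : ∀ j k, j ≠ k → ∫ x, x j * x k ∂P = 0)
    (h3 : ∀ j, (∫ x, x j ^ 2 ∂P) ^ 2 ≤ α) :
    (P.prod P).real {p | ‖p.1 - p.2‖ ^ 2 < n} ≤ (6 * s + 12 * α) / n := by
  have hn' : (0 : ℝ) < n := by exact_mod_cast hn
  have hsqm : ∀ j, MemLp (fun x : EuclideanSpace ℝ (Fin n) => x j ^ 2) 2 P := fun j =>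
    memLp_sq_of_memLp_four (hmem j)
  have hN : MemLp (fun x : EuclideanSpace ℝ (Fin n) => ‖x‖ ^ 2) 2 P := by
    simp_rw [EuclideanSpace.real_norm_sq_eq]
    exact memLp_finsetSum _ fun j _ => hsqm j
  have hi1 : Integrable (fun x : EuclideanSpace ℝ (Fin n) => (‖x‖ ^ 2 - n) ^ 2) P :=
    (hN.sub (memLp_const _)).integrable_sq
  have hia : Integrable (fun p : EuclideanSpace ℝ (Fin n) × EuclideanSpace ℝ (Fin n) =>
      (‖p.1‖ ^ 2 - n) ^ 2) (P.prod P) := hi1.comp_fst P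
  have hib : Integrable (fun p : EuclideanSpace ℝ (Fin n) × EuclideanSpace ℝ (Fin n) =>
      (‖p.2‖ ^ 2 - n) ^ 2) (P.prod P) := hi1.comp_snd P
  have hjk : ∀ j k, Integrable (fun x : EuclideanSpace ℝ (Fin n) => x j * x k) P := fun j k =>
    ((hmem j).mono_exponent (by norm_num : (2 : ℝ≥0∞) ≤ 4)).integrable_mul
      ((hmem k).mono_exponent (by norm_num : (2 : ℝ≥0∞) ≤ 4))
  have hexp : ∀ p : EuclideanSpace ℝ (Fin n) × EuclideanSpace ℝ (Fin n), ⟪p.1, p.2⟫ ^ 2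
      = ∑ j, ∑ k, (p.1 j * p.1 k) * (p.2 j * p.2 k) := by
    intro p
    rw [PiLp.inner_apply, pow_two, Finset.sum_mul_sum]
    refine Finset.sum_congr rfl fun j _ => Finset.sum_congr rfl fun k _ => ?_
    simp only [RCLike.inner_apply, conj_trivial]
    ring
  have hijk : ∀ j k, Integrable (fun p : EuclideanSpace ℝ (Fin n) × EuclideanSpace ℝ (Fin n) =>
      (p.1 j * p.1 k) * (p.2 j * p.2 k)) (P.prod P) := fun j k => (hjk j k).mul_prod (hjk j k)
  have hic : Integrable (fun p : EuclideanSpace ℝ (Fin n) × EuclideanSpace ℝ (Fin n) =>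
      ⟪p.1, p.2⟫ ^ 2) (P.prod P) := by
    simp_rw [hexp]
    exact integrable_finsetSum _ fun j _ => integrable_finsetSum _ fun k _ => hijk j k
  -- By orthogonality of the coordinates only the diagonal terms of the squared inner product remain.
  have hcross : ∫ p, ⟪p.1, p.2⟫ ^ 2 ∂(P.prod P) ≤ n * α := by
    simp_rw [hexp]
    rw [integral_finsetSum _ fun j _ => integrable_finsetSum _ fun k _ => hijk j k]
    calc _ = ∑ j : Fin n, (∫ x, x j ^ 2 ∂P) ^ 2 := by
          refine Finset.sum_congr rfl fun j _ => ?_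
          rw [integral_finsetSum _ fun k _ => hijk j k, Finset.sum_eq_single j]
          · rw [integral_prod_mul (fun x : EuclideanSpace ℝ (Fin n) => x j * x j)
              (fun x : EuclideanSpace ℝ (Fin n) => x j * x j)]
            simp only [pow_two]
          · intro k _ hk
            rw [integral_prod_mul (fun x : EuclideanSpace ℝ (Fin n) => x j * x k)
              (fun x : EuclideanSpace ℝ (Fin n) => x j * x k), h2 j k hk.symm, zero_mul]
          · simp
      _ ≤ ∑ _j : Fin n, α := Finset.sum_le_sum fun j _ => h3 j
      _ = _ := by simp
  set A : Set (EuclideanSpace ℝ (Fin n) × EuclideanSpace ℝ (Fin n)) :=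
    {p | ‖p.1 - p.2‖ ^ 2 < n} with hA
  have hAm : MeasurableSet A := measurableSet_lt (by fun_prop) (by fun_prop)
  have hint : Integrable (fun p : EuclideanSpace ℝ (Fin n) × EuclideanSpace ℝ (Fin n) =>
      3 * ((‖p.1‖ ^ 2 - n) ^ 2 + (‖p.2‖ ^ 2 - n) ^ 2 + 4 * ⟪p.1, p.2⟫ ^ 2)) (P.prod P) :=
    ((hia.add hib).add (hic.const_mul 4)).const_mul 3
  have hmark : ∫ p, A.indicator (fun _ => (n : ℝ) ^ 2) p ∂(P.prod P)
      ≤ ∫ p, 3 * ((‖p.1‖ ^ 2 - n) ^ 2 + (‖p.2‖ ^ 2 - n) ^ 2 + 4 * ⟪p.1, p.2⟫ ^ 2)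
        ∂(P.prod P) := by
    refine integral_mono ((integrable_const _).indicator hAm) hint fun p => ?_
    by_cases hp : p ∈ A
    · simp only [hp, Set.indicator_of_mem]
      -- With `a`, `b` the centred squared norms and `c` the inner product, `‖x - y‖² < n` says that
      -- `n < -(a + b - 2 c)`, and `(a + b - 2 c)² ≤ 3 (a² + b² + 4 c²)`.
      have h := norm_sub_sq_real p.1 p.2
      have hlt : ‖p.1 - p.2‖ ^ 2 < n := hp
      rw [h] at hlt
      set a := ‖p.1‖ ^ 2 - n
      set b := ‖p.2‖ ^ 2 - n
      set c := ⟪p.1, p.2⟫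
      have h5 : (n : ℝ) ≤ -(a + b - 2 * c) := by simp only [a, b]; linarith
      have h6 : (n : ℝ) ^ 2 ≤ (a + b - 2 * c) ^ 2 := by nlinarith
      nlinarith [sq_nonneg (a - b), sq_nonneg (a + 2 * c), sq_nonneg (b + 2 * c)]
    · simp only [hp, not_false_eq_true, Set.indicator_of_notMem]
      positivity
  have hiab : Integrable (fun p : EuclideanSpace ℝ (Fin n) × EuclideanSpace ℝ (Fin n) =>
      (‖p.1‖ ^ 2 - n) ^ 2 + (‖p.2‖ ^ 2 - n) ^ 2) (P.prod P) := hia.add hib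
  rw [integral_indicator_const _ hAm, integral_const_mul, integral_add hiab
    (hic.const_mul 4), integral_add hia hib, integral_const_mul, integral_fun_fst (μ := P) (ν := P)
      (fun x : EuclideanSpace ℝ (Fin n) => (‖x‖ ^ 2 - (n : ℝ)) ^ 2),
    integral_fun_snd (μ := P) (ν := P)
      (fun x : EuclideanSpace ℝ (Fin n) => (‖x‖ ^ 2 - (n : ℝ)) ^ 2)] at hmark
  simp only [probReal_univ, smul_eq_mul] at hmark
  rw [le_div_iff₀ hn']
  have h7 : (P.prod P).real A * (n : ℝ) ^ 2 ≤ (6 * s + 12 * α) * n := by linarith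
  nlinarith

end Separation

/-! ### Conditioning on the direction -/

section Projections

variable {E : Type*} [NormedAddCommGroup E] [InnerProductSpace ℝ E] [MeasurableSpace E]
  [BorelSpace E] [SecondCountableTopology E]

/-- The kernel sending a direction `u` to the law of `⟪x, u⟫` when `x` has law `P`. -/
noncomputable def projectionKernel (P : Measure E) [SFinite P] : Kernel E ℝ where
  toFun u := P.map fun x => ⟪x, u⟫
  measurable' := by
    refine Measure.measurable_of_measurable_coe _ fun s hs => ?_
    have hm : Measurable fun p : E × E => ⟪p.2, p.1⟫ := by fun_prop
    have h : ∀ u : E, P.map (fun x => ⟪x, u⟫) s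
        = P (Prod.mk u ⁻¹' ((fun p : E × E => ⟪p.2, p.1⟫) ⁻¹' s)) := fun u =>
      Measure.map_apply (by fun_prop) hs
    simp_rw [h]
    exact measurable_measure_prodMk_left (hm hs)

lemma projectionKernel_apply (P : Measure E) [SFinite P] (u : E) :
    projectionKernel P u = P.map fun x => ⟪x, u⟫ := rfl

instance (P : Measure E) [IsProbabilityMeasure P] : IsMarkovKernel (projectionKernel P) :=
  ⟨fun u => Measure.isProbabilityMeasure_map (by fun_prop)⟩

lemma charFun_projectionKernel (P : Measure E) [IsProbabilityMeasure P] (u : E) (t : ℝ) :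
    charFun (projectionKernel P u) t = charFun P (t • u) := by
  rw [projectionKernel_apply, charFun_apply, charFun_apply,
    integral_map (by fun_prop) (by fun_prop)]
  simp [inner_smul_right]

/-- If `X` has law `P` and is independent of `θ`, then the conditional law of `⟪X, θ⟫` given `θ` is
the law of `⟪x, u⟫` under `P`, evaluated at `u = θ`. -/
lemma condDistrib_inner_ae_eq {Ω : Type*} {mΩ : MeasurableSpace Ω} {μ : Measure Ω}
    [IsProbabilityMeasure μ] {θ X : Ω → E} (hθ : Measurable θ) (hX : Measurable X)
    (h : IndepFun θ X μ) [IsProbabilityMeasure (μ.map X)] :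
    condDistrib (fun ω => ⟪X ω, θ ω⟫) θ μ =ᵐ[μ.map θ] projectionKernel (μ.map X) := by
  have hm : Measurable fun p : E × E => (p.1, ⟪p.2, p.1⟫) := by fun_prop
  refine condDistrib_ae_eq_of_measure_eq_compProd_of_measurable hθ (by fun_prop) ?_
  have : IsProbabilityMeasure (μ.map θ) := Measure.isProbabilityMeasure_map hθ.aemeasurable
  have h1 : μ.map (fun ω => (θ ω, ⟪X ω, θ ω⟫))
      = ((μ.map θ).prod (μ.map X)).map fun p => (p.1, ⟪p.2, p.1⟫) := by
    rw [← (indepFun_iff_map_prod_eq_prod_map_map hθ.aemeasurable hX.aemeasurable).1 h,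
      Measure.map_map hm (by fun_prop)]
    rfl
  rw [h1]
  ext s hs
  rw [Measure.map_apply hm hs, Measure.prod_apply (hm hs), Measure.compProd_apply hs]
  refine lintegral_congr fun u => ?_
  rw [projectionKernel_apply, Measure.map_apply (by fun_prop) (measurable_prodMk_left hs)]
  rfl

lemma kolmogorovDist_eq_iSup_rat (P Q : Measure ℝ) [IsProbabilityMeasure P]
    [IsProbabilityMeasure Q] :
    kolmogorovDist P Q = ⨆ t : ℚ, |P.real (Set.Iic (t : ℝ)) - Q.real (Set.Iic (t : ℝ))| := by
  have hb := bddAbove_range_abs_real_Iic_sub P Q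
  have hb' : BddAbove (Set.range fun t : ℚ =>
      |P.real (Set.Iic (t : ℝ)) - Q.real (Set.Iic (t : ℝ))|) := by
    refine hb.mono ?_
    rintro _ ⟨t, rfl⟩
    exact ⟨(t : ℝ), rfl⟩
  refine le_antisymm (ciSup_le fun t => ?_) (ciSup_le fun t => le_ciSup hb (t : ℝ))
  -- Distribution functions are right-continuous, so `t` is approached by rationals from the right.
  obtain ⟨q, -, hq, hqt⟩ := Real.exists_seq_rat_strictAnti_tendsto t
  have hq' : Filter.Tendsto (fun k => (q k : ℝ)) Filter.atTop (nhdsWithin t (Set.Ici t)) :=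
    tendsto_nhdsWithin_iff.2 ⟨hqt, Filter.Eventually.of_forall fun k => (hq k).le⟩
  have hlim : ∀ R : Measure ℝ, IsProbabilityMeasure R →
      Filter.Tendsto (fun k => R.real (Set.Iic (q k : ℝ))) Filter.atTop
        (nhds (R.real (Set.Iic t))) := fun R _ => by
    have h := ((cdf R).right_continuous t).tendsto.comp hq'
    simpa only [cdf_eq_real, Function.comp_def] using h
  exact le_of_tendsto ((hlim P inferInstance).sub (hlim Q inferInstance)).abs
    (Filter.Eventually.of_forall fun k => le_ciSup hb' (q k))

lemma measurable_kolmogorovDist_kernel {α : Type*} [MeasurableSpace α] (κ : Kernel α ℝ)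
    [IsMarkovKernel κ] (Q : Measure ℝ) [IsProbabilityMeasure Q] :
    Measurable fun a => kolmogorovDist (κ a) Q := by
  simp_rw [kolmogorovDist_eq_iSup_rat]
  refine Measurable.iSup fun t => ?_
  have : Measurable fun a => (κ a).real (Set.Iic (t : ℝ)) :=
    (κ.measurable_coe measurableSet_Iic).ennreal_toReal
  exact (this.sub_const _).abs

end Projections

/-! ### The averaged Kolmogorov distance -/

section Assembly

lemma one_le_log_of_eight_le {n : ℕ} (hn : 8 ≤ n) : 1 ≤ Real.log n := by
  rw [Real.le_log_iff_exp_le (by positivity)]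
  have : (8 : ℝ) ≤ n := by exact_mod_cast hn
  linarith [Real.exp_one_lt_d9]

lemma exp_neg_log_div_two {x : ℝ} (hx : 0 < x) : Real.exp (-(Real.log x / 2)) = 1 / √x := by
  rw [Real.exp_neg, ← Real.log_sqrt hx.le, Real.exp_log (Real.sqrt_pos.2 hx), one_div]

variable {n : ℕ} {P : Measure (EuclideanSpace ℝ (Fin n))} [IsProbabilityMeasure P]

omit [IsProbabilityMeasure P] in
/-- Low frequencies: the smoothed characteristic function distance, averaged over the sphere. -/
lemma setLIntegral_low_frequency_le {A B T v : ℝ} (hA : 0 ≤ A) (hB : 0 ≤ B) (hT : 0 ≤ T)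
    (hv : 0 ≤ v)
    (hlow : ∀ t : ℝ, ∫⁻ u, ENNReal.ofReal ‖charFun P (t • u) - Real.exp (-t ^ 2 / 2)‖
      ∂(uniformSphere n) ≤ ENNReal.ofReal (5 * t ^ 2 * A + 4 * |t| ^ 3 * B)) :
    ∫⁻ t in {t : ℝ | T ≤ |t|}ᶜ, ∫⁻ u, ENNReal.ofReal (Real.exp (-(v / 2) * t ^ 2) *
        (‖charFun P (t • u) - Real.exp (-t ^ 2 / 2)‖ / |t|)) ∂(uniformSphere n)
      ≤ ENNReal.ofReal (10 * T ^ 2 * A + 8 * T ^ 3 * B) := by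
  have hpt : ∀ t : ℝ, |t| ≤ T → ∫⁻ u, ENNReal.ofReal (Real.exp (-(v / 2) * t ^ 2) *
      (‖charFun P (t • u) - Real.exp (-t ^ 2 / 2)‖ / |t|)) ∂(uniformSphere n)
      ≤ ENNReal.ofReal (5 * T * A + 4 * T ^ 2 * B) := fun t ht => by
    have he : Real.exp (-(v / 2) * t ^ 2) ≤ 1 :=
      Real.exp_le_one_iff.2 (by nlinarith [sq_nonneg t])
    calc _ ≤ ∫⁻ u, ENNReal.ofReal (1 / |t|)
            * ENNReal.ofReal ‖charFun P (t • u) - Real.exp (-t ^ 2 / 2)‖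
            ∂(uniformSphere n) := by
          refine lintegral_mono fun u => ?_
          rw [← ENNReal.ofReal_mul (by positivity)]
          refine ENNReal.ofReal_le_ofReal ?_
          rw [one_div, inv_mul_eq_div]
          exact mul_le_of_le_one_left (by positivity) he
      _ = ENNReal.ofReal (1 / |t|) * ∫⁻ u, ENNReal.ofReal
            ‖charFun P (t • u) - Real.exp (-t ^ 2 / 2)‖ ∂(uniformSphere n) :=
          lintegral_const_mul' _ _ ENNReal.ofReal_ne_top
      _ ≤ ENNReal.ofReal (1 / |t|) * ENNReal.ofReal (5 * t ^ 2 * A + 4 * |t| ^ 3 * B) := by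
          gcongr
          exact hlow t
      _ = ENNReal.ofReal (5 * |t| * A + 4 * |t| ^ 2 * B) := by
          rw [← ENNReal.ofReal_mul (by positivity)]
          congr 1
          rcases eq_or_ne t 0 with rfl | h0
          · simp
          · have : |t| ≠ 0 := abs_ne_zero.2 h0
            rw [← sq_abs t]
            field_simp
      _ ≤ _ := by gcongr
  calc _ ≤ ∫⁻ t in {t : ℝ | T ≤ |t|}ᶜ, ENNReal.ofReal (5 * T * A + 4 * T ^ 2 * B) := by
        refine setLIntegral_mono measurable_const fun t ht => hpt t ?_
        have : ¬ T ≤ |t| := ht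
        exact (not_le.1 this).le
    _ ≤ ∫⁻ t in Metric.ball (0 : ℝ) T, ENNReal.ofReal (5 * T * A + 4 * T ^ 2 * B) := by
        refine lintegral_mono_set fun t ht => ?_
        have : ¬ T ≤ |t| := ht
        simpa using not_le.1 this
    _ = _ := by
        rw [setLIntegral_const, Real.volume_ball, ← ENNReal.ofReal_mul (by positivity)]
        congr 1
        ring

/-- High frequencies: the characteristic function averaged over the sphere is compared with its
Gaussian average, which is small by the separation of two independent copies. -/
lemma setLIntegral_high_frequency_le (hn : 8 ≤ n) {b q : ℝ} (hb : 1 ≤ b) (hq : 0 ≤ q)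
    (hsep : (P.prod P).real {p | ‖p.1 - p.2‖ ^ 2 < n} ≤ q) :
    ∫⁻ t in {t : ℝ | 2 * b ≤ |t|}, ∫⁻ u, ENNReal.ofReal (Real.exp (-(((n : ℝ)⁻¹) / 2) * t ^ 2) *
        (‖charFun P (t • u) - Real.exp (-t ^ 2 / 2)‖ / |t|)) ∂(uniformSphere n)
      ≤ ENNReal.ofReal (12 * Real.exp (-b ^ 2 / 4) + 2 * √q * (Real.log n + 8)) := by
  have hn0 : (0 : ℝ) < n := by positivity
  have hprob : IsProbabilityMeasure (uniformSphere n) :=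
    isProbabilityMeasure_uniformSphere (by omega)
  have hL : 1 ≤ Real.log n := one_le_log_of_eight_le hn
  have hfm : Measurable fun u : EuclideanSpace ℝ (Fin n) => ‖charFun P u‖ₑ :=
    continuous_charFun_of_isProbabilityMeasure.measurable.enorm
  have hbm : MeasurableSet {t : ℝ | b ≤ |t|} := measurableSet_le measurable_const measurable_norm
  have hgauss : ∫⁻ t in {t : ℝ | 2 * b ≤ |t|}, ENNReal.ofReal (Real.exp (-t ^ 2 / 4) / |t|)
      ≤ ENNReal.ofReal (4 * Real.exp (-b ^ 2 / 4)) := by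
    refine (lintegral_mono_set fun t ht => ?_).trans (setLIntegral_exp_div_abs_le hb)
    have : 2 * b ≤ |t| := ht
    exact (by linarith : b ≤ |t|)
  have hpt : ∀ t : ℝ, ∫⁻ u, ENNReal.ofReal (Real.exp (-(((n : ℝ)⁻¹) / 2) * t ^ 2) *
      (‖charFun P (t • u) - Real.exp (-t ^ 2 / 2)‖ / |t|)) ∂(uniformSphere n)
      ≤ ENNReal.ofReal (Real.exp (-t ^ 2 / (2 * n)) / |t|) *
          ∫⁻ u, ‖charFun P (t • u)‖ₑ ∂(uniformSphere n)
        + ENNReal.ofReal (Real.exp (-t ^ 2 / 4) / |t|) := fun t => by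
    have hexp : -(((n : ℝ)⁻¹) / 2) * t ^ 2 = -t ^ 2 / (2 * n) := by field_simp
    have he : Real.exp (-t ^ 2 / (2 * n)) ≤ 1 :=
      Real.exp_le_one_iff.2 (div_nonpos_of_nonpos_of_nonneg (by nlinarith [sq_nonneg t])
        (by positivity))
    have he2 : Real.exp (-t ^ 2 / 2) ≤ Real.exp (-t ^ 2 / 4) :=
      Real.exp_le_exp.2 (by nlinarith [sq_nonneg t])
    rw [hexp]
    calc _ ≤ ∫⁻ u, (ENNReal.ofReal (Real.exp (-t ^ 2 / (2 * n)) / |t|) * ‖charFun P (t • u)‖ₑ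
            + ENNReal.ofReal (Real.exp (-t ^ 2 / 4) / |t|)) ∂(uniformSphere n) := by
          refine lintegral_mono fun u => ?_
          rw [← ofReal_norm, ← ENNReal.ofReal_mul (by positivity),
            ← ENNReal.ofReal_add (by positivity) (by positivity)]
          refine ENNReal.ofReal_le_ofReal ?_
          have h1 : ‖charFun P (t • u) - Real.exp (-t ^ 2 / 2)‖
              ≤ ‖charFun P (t • u)‖ + Real.exp (-t ^ 2 / 2) := by
            refine (norm_sub_le _ _).trans (add_le_add_right (le_of_eq ?_) _)
            rw [Complex.norm_real, Real.norm_of_nonneg (Real.exp_pos _).le]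
          calc _ ≤ Real.exp (-t ^ 2 / (2 * n)) *
                ((‖charFun P (t • u)‖ + Real.exp (-t ^ 2 / 2)) / |t|) := by gcongr
            _ = Real.exp (-t ^ 2 / (2 * n)) / |t| * ‖charFun P (t • u)‖
                + Real.exp (-t ^ 2 / (2 * n)) * (Real.exp (-t ^ 2 / 2) / |t|) := by ring
            _ ≤ _ := by
                refine add_le_add_right ((mul_le_of_le_one_left (by positivity) he).trans ?_) _
                gcongr
      _ = _ := by
          rw [lintegral_add_right _ measurable_const, lintegral_const, measure_univ, mul_one,
            lintegral_const_mul' _ _ ENNReal.ofReal_ne_top]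
  calc _ ≤ ∫⁻ t in {t : ℝ | 2 * b ≤ |t|},
          (ENNReal.ofReal (Real.exp (-t ^ 2 / (2 * n)) / |t|) *
            ∫⁻ u, ‖charFun P (t • u)‖ₑ ∂(uniformSphere n)
          + ENNReal.ofReal (Real.exp (-t ^ 2 / 4) / |t|)) := lintegral_mono hpt
    _ = (∫⁻ t in {t : ℝ | 2 * b ≤ |t|}, ENNReal.ofReal (Real.exp (-t ^ 2 / (2 * n)) / |t|) *
            ∫⁻ u, ‖charFun P (t • u)‖ₑ ∂(uniformSphere n))
          + ∫⁻ t in {t : ℝ | 2 * b ≤ |t|}, ENNReal.ofReal (Real.exp (-t ^ 2 / 4) / |t|) :=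
        lintegral_add_right _ (by fun_prop)
    _ ≤ 2 * (∫⁻ t in {t : ℝ | b ≤ |t|}, ENNReal.ofReal (Real.exp (-t ^ 2 / (8 * n)) / |t|) *
            ∫⁻ x, ‖charFun P ((t / √n) • x)‖ₑ ∂(stdGaussian (EuclideanSpace ℝ (Fin n))))
          + ENNReal.ofReal (4 * Real.exp (-b ^ 2 / 4)) :=
        add_le_add (lintegral_uniformSphere_le_stdGaussian hn hfm b) hgauss
    _ ≤ 2 * (∫⁻ t in {t : ℝ | b ≤ |t|}, (ENNReal.ofReal (Real.exp (-t ^ 2 / 4) / |t|)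
            + ENNReal.ofReal √q * ENNReal.ofReal (Real.exp (-t ^ 2 / (8 * n)) / |t|)))
          + ENNReal.ofReal (4 * Real.exp (-b ^ 2 / 4)) := by
        gcongr with t
        refine (mul_le_mul_right
          (lintegral_enorm_charFun_stdGaussian_le hn0 hq hsep t) _).trans ?_
        rw [← ENNReal.ofReal_mul (by positivity), ← ENNReal.ofReal_mul (by positivity),
          ← ENNReal.ofReal_add (by positivity) (by positivity)]
        refine ENNReal.ofReal_le_ofReal ?_
        have he : Real.exp (-t ^ 2 / (8 * n)) ≤ 1 :=
          Real.exp_le_one_iff.2 (div_nonpos_of_nonpos_of_nonneg (by nlinarith [sq_nonneg t])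
            (by positivity))
        calc Real.exp (-t ^ 2 / (8 * n)) / |t| * (Real.exp (-t ^ 2 / 4) + √q)
            = Real.exp (-t ^ 2 / (8 * n)) * (Real.exp (-t ^ 2 / 4) / |t|)
              + √q * (Real.exp (-t ^ 2 / (8 * n)) / |t|) := by ring
          _ ≤ _ := by
              gcongr
              exact mul_le_of_le_one_left (by positivity) he
    _ ≤ 2 * (ENNReal.ofReal (4 * Real.exp (-b ^ 2 / 4))
            + ENNReal.ofReal √q * ENNReal.ofReal (Real.log n + 8))
          + ENNReal.ofReal (4 * Real.exp (-b ^ 2 / 4)) := by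
        rw [lintegral_add_left (by fun_prop), lintegral_const_mul' _ _ ENNReal.ofReal_ne_top]
        gcongr
        · exact setLIntegral_exp_div_abs_le hb
        · exact setLIntegral_exp_div_abs_le_log (by exact_mod_cast (by omega : 1 ≤ n)) hb
    _ = _ := by
        have h2 : (2 : ℝ≥0∞) = ENNReal.ofReal 2 := by simp
        rw [h2, ← ENNReal.ofReal_mul (by positivity), ← ENNReal.ofReal_add (by positivity)
          (by positivity), ← ENNReal.ofReal_mul (by positivity),
          ← ENNReal.ofReal_add (by positivity) (by positivity)]
        congr 1
        ring

/-- The averaged Kolmogorov distance of the projections of a law `P`, in terms of a low-frequency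
comparison with errors `A` and `B` and of the probability `q` that two independent copies are
close. -/
lemma lintegral_kolmogorovDist_projection_le (hn : 8 ≤ n) {A B q : ℝ} (hA : 0 ≤ A) (hB : 0 ≤ B)
    (hq : 0 ≤ q) (hint : ∀ u, Integrable (fun x => x) (projectionKernel P u))
    (hlow : ∀ t : ℝ, ∫⁻ u, ENNReal.ofReal ‖charFun P (t • u) - Real.exp (-t ^ 2 / 2)‖
      ∂(uniformSphere n) ≤ ENNReal.ofReal (5 * t ^ 2 * A + 4 * |t| ^ 3 * B))
    (hsep : (P.prod P).real {p | ‖p.1 - p.2‖ ^ 2 < n} ≤ q) :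
    ∫⁻ u, ENNReal.ofReal (kolmogorovDist (projectionKernel P u) (gaussianReal 0 1))
        ∂(uniformSphere n)
      ≤ ENNReal.ofReal (160 * Real.log n * A + 512 * Real.log n ^ 2 * B
          + 4 * √q * (Real.log n + 8) + 30 / √n) := by
  have hn0 : (0 : ℝ) < n := by positivity
  have hprob : IsProbabilityMeasure (uniformSphere n) :=
    isProbabilityMeasure_uniformSphere (by omega)
  have hL : 1 ≤ Real.log n := one_le_log_of_eight_le hn
  -- The frequencies are cut at `2 b`, chosen so that `exp (-b ^ 2 / 4) = 1 / √n`.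
  set b : ℝ := √(2 * Real.log n) with hbdef
  have hb2 : b ^ 2 = 2 * Real.log n := Real.sq_sqrt (by positivity)
  have hb1 : 1 ≤ b := by rw [hbdef, Real.one_le_sqrt]; linarith
  have hexpb : Real.exp (-b ^ 2 / 4) = 1 / √n := by
    rw [← exp_neg_log_div_two hn0, hb2]
    congr 1
    ring
  have hb3 : b ^ 3 ≤ 4 * Real.log n ^ 2 := by nlinarith
  have hv : ((n : ℝ≥0)⁻¹) ≠ 0 := inv_ne_zero (by exact_mod_cast (by omega : n ≠ 0))
  set F : EuclideanSpace ℝ (Fin n) → ℝ → ℝ≥0∞ := fun u t =>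
    ENNReal.ofReal (Real.exp (-(((n : ℝ)⁻¹) / 2) * t ^ 2) *
      (‖charFun P (t • u) - Real.exp (-t ^ 2 / 2)‖ / |t|)) with hF
  have hFm : Measurable (Function.uncurry F) := by
    have hc : Measurable fun p : EuclideanSpace ℝ (Fin n) × ℝ => charFun P (p.2 • p.1) :=
      continuous_charFun_of_isProbabilityMeasure.measurable.comp (by fun_prop)
    simp only [hF, Function.uncurry_def]
    fun_prop
  have hsm : √((n : ℝ≥0)⁻¹ : ℝ≥0) = 1 / √(n : ℝ) := by simp
  have hK : ∀ u, ENNReal.ofReal (kolmogorovDist (projectionKernel P u) (gaussianReal 0 1))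
      ≤ 2 * (∫⁻ t, F u t) + ENNReal.ofReal (6 / √n) := fun u => by
    have h := ofReal_kolmogorovDist_le hv (hint u)
    simp only [charFun_projectionKernel, hsm] at h
    rw [mul_one_div] at h
    simpa [hF] using h
  calc _ ≤ ∫⁻ u, (2 * (∫⁻ t, F u t) + ENNReal.ofReal (6 / √n)) ∂(uniformSphere n) :=
        lintegral_mono hK
    _ = 2 * (∫⁻ t, ∫⁻ u, F u t ∂(uniformSphere n)) + ENNReal.ofReal (6 / √n) := by
        rw [lintegral_add_right _ measurable_const, lintegral_const, measure_univ, mul_one,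
          lintegral_const_mul' _ _ (by simp), lintegral_lintegral_swap hFm.aemeasurable]
    _ = 2 * ((∫⁻ t in {t : ℝ | 2 * b ≤ |t|}, ∫⁻ u, F u t ∂(uniformSphere n))
          + ∫⁻ t in {t : ℝ | 2 * b ≤ |t|}ᶜ, ∫⁻ u, F u t ∂(uniformSphere n))
          + ENNReal.ofReal (6 / √n) := by
        have hm : MeasurableSet {t : ℝ | 2 * b ≤ |t|} :=
          measurableSet_le measurable_const measurable_norm
        rw [lintegral_add_compl _ hm]
    _ ≤ 2 * (ENNReal.ofReal (12 * Real.exp (-b ^ 2 / 4) + 2 * √q * (Real.log n + 8))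
          + ENNReal.ofReal (10 * (2 * b) ^ 2 * A + 8 * (2 * b) ^ 3 * B))
          + ENNReal.ofReal (6 / √n) := by
        gcongr
        · exact setLIntegral_high_frequency_le hn hb1 hq hsep
        · exact setLIntegral_low_frequency_le hA hB (by positivity) (by positivity) hlow
    _ ≤ _ := by
        have h2 : (2 : ℝ≥0∞) = ENNReal.ofReal 2 := by simp
        rw [h2, ← ENNReal.ofReal_add (by positivity) (by positivity),
          ← ENNReal.ofReal_mul (by positivity), ← ENNReal.ofReal_add (by positivity)
          (by positivity)]
        refine ENNReal.ofReal_le_ofReal ?_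
        rw [hexpb]
        have h3 : b ^ 3 * B ≤ 4 * Real.log n ^ 2 * B := by gcongr
        have h4 : b ^ 2 * A = 2 * Real.log n * A := by rw [hb2]
        have h5 : (6 : ℝ) / √n = 6 * (1 / √n) := by ring
        have h6 : (30 : ℝ) / √n = 30 * (1 / √n) := by ring
        rw [h5, h6]
        nlinarith

end Assembly

/-! ### Martingale differences with random weights -/

section Martingale

variable {Ω : Type*} {mΩ : MeasurableSpace Ω} {μ : Measure Ω} [IsProbabilityMeasure μ] {n : ℕ}
  {ℱ : Filtration (Fin (n + 1)) mΩ} {d : Fin n → Ω → ℝ}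

omit [IsProbabilityMeasure μ] in
lemma integral_pow_four_le_alpha (k : Fin n) : ∫ ω, d k ω ^ 4 ∂μ ≤ alpha d μ :=
  le_ciSup (Set.finite_range fun k => ∫ ω, d k ω ^ 4 ∂μ).bddAbove k

omit [IsProbabilityMeasure μ] in
lemma alpha_nonneg : 0 ≤ alpha d μ :=
  Real.iSup_nonneg fun _ => integral_nonneg fun _ => by positivity

omit [IsProbabilityMeasure μ] in
lemma le_vPrime : cTwo d μ * sigmaFourSq d μ * Real.log n + alpha d μ * Real.log n ^ 2
    ≤ vPrime d ℱ μ := by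
  have hβ : 0 ≤ beta d ℱ μ := integral_nonneg fun _ => Real.sqrt_nonneg _
  have h : 0 ≤ beta d ℱ μ * Real.log n ^ (3 / 2 : ℝ) :=
    mul_nonneg hβ (Real.rpow_nonneg (Real.log_natCast_nonneg n) _)
  unfold vPrime
  linarith

omit [IsProbabilityMeasure μ] in
lemma vPrime_nonneg : 0 ≤ vPrime d ℱ μ := by
  refine le_trans ?_ le_vPrime
  have hc : 0 ≤ cTwo d μ := Real.sqrt_nonneg _
  have hs : 0 ≤ sigmaFourSq d μ := sigmaFourSq_nonneg
  have hL : 0 ≤ Real.log n := Real.log_natCast_nonneg n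
  have ha : 0 ≤ alpha d μ := alpha_nonneg
  positivity

/-- The bound obtained from the two frequency ranges is of the order of `1 + vPrime`, because
`√s ≤ 1 + c * s` as soon as `√s ≤ c`. -/
lemma frequency_bound_le {s c α L m : ℝ} (hs : 0 ≤ s) (hc : √s ≤ c) (hα : 1 ≤ α) (hL : 1 ≤ L)
    (hm : 0 < m) :
    160 * L * √((s + 2 * α) / m) + 512 * L ^ 2 * (2 * α / √m)
        + 4 * √((6 * s + 12 * α) / m) * (L + 8) + 30 / √m
      ≤ 2000 * ((1 + (c * s * L + α * L ^ 2)) / √m) := by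
  have hm' : 0 < √m := Real.sqrt_pos.2 hm
  have hc0 : 0 ≤ c := (Real.sqrt_nonneg s).trans hc
  have hcs : 0 ≤ c * s := by positivity
  have hsq : √s ≤ 1 + c * s := by
    rcases le_total s 1 with h | h
    · have := Real.sqrt_le_one.2 h
      linarith
    · have h1 : 1 ≤ √s := Real.one_le_sqrt.2 h
      have h2 : √s ≤ s := by nlinarith [Real.sq_sqrt hs]
      nlinarith
  have hA : √(s + 2 * α) ≤ c * s + 3 * α := by
    refine Real.sqrt_le_iff.2 ⟨by positivity, ?_⟩
    have h1 : s ≤ (1 + c * s) ^ 2 := by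
      exact (Real.sqrt_le_left (by positivity)).1 hsq
    nlinarith
  have hq : √(6 * s + 12 * α) ≤ 3 * (c * s + 3 * α) := by
    refine Real.sqrt_le_iff.2 ⟨by positivity, ?_⟩
    have h1 : s + 2 * α ≤ (c * s + 3 * α) ^ 2 := (Real.sqrt_le_left (by positivity)).1 hA
    nlinarith
  rw [Real.sqrt_div (by positivity), Real.sqrt_div (by positivity)]
  calc _ = (160 * L * √(s + 2 * α) + 1024 * L ^ 2 * α
          + 4 * √(6 * s + 12 * α) * (L + 8) + 30) / √m := by ring
    _ ≤ (160 * L * (c * s + 3 * α) + 1024 * L ^ 2 * α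
          + 4 * (3 * (c * s + 3 * α)) * (L + 8) + 30) / √m := by gcongr
    _ ≤ (2000 * (1 + (c * s * L + α * L ^ 2))) / √m := by
        gcongr
        have h1 : c * s ≤ c * s * L := le_mul_of_one_le_right hcs hL
        have h2 : L ≤ L ^ 2 := by nlinarith
        have h3 : α * L ≤ α * L ^ 2 := by gcongr
        have h4 : α ≤ α * L := le_mul_of_one_le_right (by linarith) hL
        nlinarith
    _ = _ := by ring

lemma IsMartingaleDifference.lintegral_kolmogorovDist_le (hn : 8 ≤ n)
    (hd : IsMartingaleDifference d ℱ μ) (hL4 : ∀ k, MemLp (d k) 4 μ)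
    (hsum : ∑ k, ∫ ω, d k ω ^ 2 ∂μ = (n : ℝ)) :
    ∫⁻ u, ENNReal.ofReal
        (kolmogorovDist (projectionKernel (μ.map (diffVector d)) u) (gaussianReal 0 1))
        ∂(uniformSphere n)
      ≤ ENNReal.ofReal (2000 * ((1 + vPrime d ℱ μ) / √n)) := by
  have hn0 : 0 < n := by omega
  have hnr : (0 : ℝ) < n := by exact_mod_cast hn0
  have hdm := hd.measurable'
  have hV : Measurable (diffVector d) := measurable_diffVector hdm
  have hP : IsProbabilityMeasure (μ.map (diffVector d)) :=
    Measure.isProbabilityMeasure_map hV.aemeasurable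
  have hα : ∀ k, ∫ ω, d k ω ^ 4 ∂μ ≤ alpha d μ := integral_pow_four_le_alpha
  have hα1 : 1 ≤ alpha d μ := one_le_of_fourth_moment_le hn0 hL4 hα hsum
  have hs : 0 ≤ sigmaFourSq d μ := sigmaFourSq_nonneg
  have hint : ∀ u, Integrable (fun x => x) (projectionKernel (μ.map (diffVector d)) u) := by
    intro u
    rw [projectionKernel_apply, Measure.map_map (by fun_prop) hV,
      integrable_map_measure (by fun_prop) (by fun_prop)]
    simp only [Function.comp_def, inner_diffVector]
    exact integrable_finsetSum _ fun k _ => (hd.integrable k).const_mul _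
  have hsep := prod_real_norm_sub_sq_lt_le (P := μ.map (diffVector d)) hn0
    (s := sigmaFourSq d μ) (α := alpha d μ)
    (fun j => by
      rw [memLp_map_measure_iff (by fun_prop) hV.aemeasurable]
      exact hL4 j)
    (by
      rw [integral_map hV.aemeasurable (by fun_prop), ← integral_sum_sq_sub_sq hn0 hL4 hsum]
      simp [EuclideanSpace.real_norm_sq_eq, diffVector])
    (fun j k hjk => by
      rw [integral_map hV.aemeasurable (by fun_prop)]
      exact hd.integral_mul_eq_zero hL4 hjk)
    (fun j => by
      rw [integral_map hV.aemeasurable (by fun_prop)]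
      exact (sq_integral_sq_le (hL4 j)).trans (hα j))
  refine (lintegral_kolmogorovDist_projection_le hn (Real.sqrt_nonneg _)
    (show 0 ≤ 2 * alpha d μ / √n by positivity) (by positivity) hint
    (hd.lintegral_norm_charFun_sub_le hn0 hL4 hα hsum) hsep).trans
    (ENNReal.ofReal_le_ofReal ?_)
  refine (frequency_bound_le hs (sqrt_sigmaFourSq_le_cTwo hL4) hα1
    (one_le_log_of_eight_le hn) hnr).trans ?_
  gcongr
  exact le_vPrime

/-- In small dimension the trivial bound of the distance by one is enough. -/
lemma lintegral_kolmogorovDist_le_of_lt_eight (hn0 : 0 < n) (hn : n < 8) {w : ℝ} (hw : 0 ≤ w)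
    (P : Measure (EuclideanSpace ℝ (Fin n))) [IsProbabilityMeasure P] :
    ∫⁻ u, ENNReal.ofReal (kolmogorovDist (projectionKernel P u) (gaussianReal 0 1))
        ∂(uniformSphere n)
      ≤ ENNReal.ofReal (2000 * ((1 + w) / √n)) := by
  have hprob := isProbabilityMeasure_uniformSphere hn0
  have hm : 0 < √(n : ℝ) := Real.sqrt_pos.2 (by exact_mod_cast hn0)
  have hm8 : √(n : ℝ) ≤ 8 := by
    have h8 : (n : ℝ) ≤ 8 := by exact_mod_cast hn.le
    exact Real.sqrt_le_iff.2 ⟨by norm_num, by linarith⟩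
  calc _ ≤ ∫⁻ _u, ENNReal.ofReal 1 ∂(uniformSphere n) :=
        lintegral_mono fun u => ENNReal.ofReal_le_ofReal (kolmogorovDist_le_one)
    _ = ENNReal.ofReal 1 := by simp
    _ ≤ _ := by
        refine ENNReal.ofReal_le_ofReal ?_
        rw [← mul_div_assoc, one_le_div hm]
        linarith

/-- The conditional law of the weighted sum given its weights is the projection of the law of
`(d₁, …, dₙ)` in the direction of the weights, so that the bound averaged over the sphere applies. -/
lemma IsMartingaleDifference.integrable_and_integral_kolmogorovDist_le (hn : 2 ≤ n)
    {θ : Ω → EuclideanSpace ℝ (Fin n)} (hd : IsMartingaleDifference d ℱ μ)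
    (hL4 : ∀ k, MemLp (d k) 4 μ) (hsum : ∑ k, ∫ ω, d k ω ^ 2 ∂μ = (n : ℝ)) (hθ : Measurable θ)
    (hθlaw : μ.map θ = uniformSphere n) (hindep : IndepFun θ (fun ω k => d k ω) μ) :
    Integrable (fun ω => kolmogorovDist (condDistrib (weightedSum θ d) θ μ (θ ω))
        (gaussianReal 0 1)) μ ∧
      ∫ ω, kolmogorovDist (condDistrib (weightedSum θ d) θ μ (θ ω)) (gaussianReal 0 1) ∂μ
        ≤ 2000 * ((1 + vPrime d ℱ μ) / √(n : ℝ)) := by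
  have hV : Measurable (diffVector d) := measurable_diffVector hd.measurable'
  have hP : IsProbabilityMeasure (μ.map (diffVector d)) :=
    Measure.isProbabilityMeasure_map hV.aemeasurable
  have hvec : IndepFun θ (diffVector d) μ :=
    hindep.comp measurable_id (WithLp.measurable_toLp 2 (Fin n → ℝ))
  have hS : weightedSum θ d = fun ω => ⟪diffVector d ω, θ ω⟫ :=
    funext fun ω => (inner_diffVector (θ ω) ω).symm
  have hm : Measurable fun u =>
      kolmogorovDist (projectionKernel (μ.map (diffVector d)) u) (gaussianReal 0 1) :=
    measurable_kolmogorovDist_kernel _ _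
  -- By independence, conditioning on `θ` amounts to fixing the direction of projection.
  have hae : (fun ω => kolmogorovDist (condDistrib (weightedSum θ d) θ μ (θ ω))
      (gaussianReal 0 1)) =ᵐ[μ] fun ω =>
        kolmogorovDist (projectionKernel (μ.map (diffVector d)) (θ ω)) (gaussianReal 0 1) := by
    rw [hS]
    filter_upwards [ae_of_ae_map hθ.aemeasurable (condDistrib_inner_ae_eq hθ hV hvec)] with ω hω
    rw [hω]
  have hint : Integrable (fun ω =>
      kolmogorovDist (projectionKernel (μ.map (diffVector d)) (θ ω)) (gaussianReal 0 1)) μ := by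
    refine Integrable.of_bound (hm.comp hθ).aestronglyMeasurable 1 (ae_of_all _ fun ω => ?_)
    rw [Real.norm_of_nonneg (kolmogorovDist_nonneg)]
    exact kolmogorovDist_le_one
  refine ⟨hint.congr hae.symm, ?_⟩
  rw [integral_congr_ae hae, integral_eq_lintegral_of_nonneg_ae
    (ae_of_all _ fun ω => kolmogorovDist_nonneg) hint.aestronglyMeasurable]
  refine ENNReal.toReal_le_of_le_ofReal ?_ ?_
  · have := vPrime_nonneg (d := d) (ℱ := ℱ) (μ := μ)
    positivity
  · rw [← lintegral_map (f := fun u => ENNReal.ofReal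
      (kolmogorovDist (projectionKernel (μ.map (diffVector d)) u) (gaussianReal 0 1)))
      hm.ennreal_ofReal hθ, hθlaw]
    rcases lt_or_ge n 8 with h8 | h8
    · exact lintegral_kolmogorovDist_le_of_lt_eight (by omega) h8 vPrime_nonneg _
    · exact hd.lintegral_kolmogorovDist_le h8 hL4 hsum

end Martingale

end RandomizedMartingale

theorem theorem2 :
    ∃ C : ℝ, 0 < C ∧
      ∀ (n : ℕ), 2 ≤ n →
      ∀ (Ω : Type*) (mΩ : MeasurableSpace Ω) (μ : Measure Ω) [IsProbabilityMeasure μ]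
        (ℱ : Filtration (Fin (n + 1)) mΩ) (d : Fin n → Ω → ℝ)
        (θ : Ω → EuclideanSpace ℝ (Fin n)),
        RandomizedMartingale.IsMartingaleDifference d ℱ μ →
        (∀ k, MemLp (d k) 4 μ) →
        ∑ k, ∫ ω, d k ω ^ 2 ∂μ = (n : ℝ) →
        Measurable θ →
        Measure.map θ μ = RandomizedMartingale.uniformSphere n →
        IndepFun θ (fun ω k => d k ω) μ →
        Integrable (fun ω => RandomizedMartingale.kolmogorovDist
            (condDistrib (RandomizedMartingale.weightedSum θ d) θ μ (θ ω))
            (gaussianReal 0 1)) μ ∧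
        ∫ ω, RandomizedMartingale.kolmogorovDist
            (condDistrib (RandomizedMartingale.weightedSum θ d) θ μ (θ ω))
            (gaussianReal 0 1) ∂μ
          ≤ C * ((1 + RandomizedMartingale.vPrime d ℱ μ) / √(n : ℝ)) :=
  ⟨2000, by norm_num, fun _ hn _ _ _ _ _ _ _ hd hL4 hsum hθ hθlaw hindep =>
    hd.integrable_and_integral_kolmogorovDist_le hn hL4 hsum hθ hθlaw hindep⟩
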